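/- **Setting.** A warehouse is a rectilinear grid of length $L\ge 0$ and width $W\ge 0$ with $a\ge 1$ equidistant parallel aisles (segments of length $W$) and $b\ge 2$ equidistant cross-aisles (segments of length $L$), the outer ones bounding the grid; $d$ is the shortest-path distance in this network and the depot $l_d$ is a point of it. A single picker walks at unit speed, starts at the depot at time $0$, and has a cart with $c\ge 1$ bins; picking takes no time. An instance $I(n)$ consists of orders $o_1,\dots,o_n$, each a nonempty finite set of picking locations in the aisles, and arrival times $0\le r_1\le\dots\le r_n$. Orders are collected in successive batches of at most $c$ orders; an order may not be split between batches, and no item of $o_j$ can be picked before $r_j$. With a *pushcart*, the picker returns to the depot at the end of each batch, and the completion time is the time of the last return; with a *robot*, she starts the next batch where the previous one ended, and the completion time is the time of the last pick. $CIOPT(I)$ is the least completion time over all choices of batches, sequence of batches and visiting sequences within the batches when the whole instance is known in advance. $Reopt(I)$ is the completion time of the following online policy, where ties between optimal plans and between shortest routes are broken arbitrarily. In *Pcart-N* (pushcart), whenever the picker is at the depot and newly arrived orders are available, a plan of minimal completion time is computed for all orders that have arrived and are not yet picked, treated as immediately available; started batches are never changed, and when nothing is left to do she waits at the depot. In *Pcart*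 (pushcart) and *Robot* (robot), at every arrival of a new order a plan of minimal completion time is computed for all items that belong to arrived orders and are not yet picked, starting from the current position of the picker; orders that have picked items in the current cart must be completed in the current batch, and its empty bins may be (re)assigned to any order not yet commenced. **Theorem.** Let $O_1,O_2,\dots$ be i.i.d. random orders, $O_j=(K_j,S_j^1,\dots,S_j^{K_j})$ with $K_j\ge 1$, and let $Y_1,Y_2,\dots\ge 0$ be i.i.d. random variables with finite mean such that the sequences $(O_j)_j$ and $(Y_j)_j$ are independent. Let $I(n)$ be the random instance with orders $O_1,\dots,O_n$ and arrival times $R_j=Y_{(j)}$, where $Y_{(1)}\le\dots\le Y_{(n)}$ are the order statistics of $Y_1,\dots,Y_n$. Assume that it is not the case that almost surely $Y_1=0$ and all picking locations of $O_1$ are at the depot; in *Robot*, assume also that the expected number of distinct picking locations of $O_1$ is larger than $1$. Then, in each of the systems *Pcart-N*, *Pcart* and *Robot*, $Reopt(I(n))$ is well defined for every $n$ almost surely, and, however ties are broken, $$\lim_{n\to\infty}\frac{Reopt(I(n))}{CIOPT(I(n))}=1\qquad\text{almost surely.}$$ -/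

import Mathlib

open MeasureTheory ProbabilityTheory Filter Topology
open scoped ENNReal

noncomputable section

namespace OrderPicking

/-- A point of the floor plan. The first coordinate runs along the cross-aisles (the length of the
warehouse), the second one along the aisles (its width). -/
abbrev Pt := ℝ × ℝ

/-- A rectilinear warehouse of length `len` and width `wid` with `a ≥ 1` equidistant parallel aisles
and `b ≥ 2` equidistant cross-aisles; the outer ones bound the warehouse. -/
structure Warehouse where
  len : ℝ
  wid : ℝ
  a : ℕ
  b : ℕ
  depot : Pt
  len_nonneg : 0 ≤ len
  wid_nonneg : 0 ≤ wid
  one_le_a : 1 ≤ a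
  two_le_b : 2 ≤ b
  /-- The depot lies in an aisle or in a cross-aisle. -/
  depot_mem :
    ((∃ i < a, depot.1 = i * (len / (a - 1))) ∧ 0 ≤ depot.2 ∧ depot.2 ≤ wid) ∨
    ((∃ k < b, depot.2 = k * (wid / (b - 1))) ∧ 0 ≤ depot.1 ∧ depot.1 ≤ len)

namespace Warehouse

variable (w : Warehouse)

/-- The point lies in one of the aisles (a single aisle, `a = 1`, has first coordinate `0`). -/
def OnAisle (p : Pt) : Prop :=
  (∃ i < w.a, p.1 = i * (w.len / (w.a - 1))) ∧ 0 ≤ p.2 ∧ p.2 ≤ w.wid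

/-- The point lies in one of the cross-aisles. -/
def OnCross (p : Pt) : Prop :=
  (∃ k < w.b, p.2 = k * (w.wid / (w.b - 1))) ∧ 0 ≤ p.1 ∧ p.1 ≤ w.len

/-- The positions that the picker can take. -/
def Walkable (p : Pt) : Prop := w.OnAisle p ∨ w.OnCross p

/-- A straight walk from `p` to `q` within one aisle or within one cross-aisle. -/
def Straight (p q : Pt) : Prop :=
  (w.OnAisle p ∧ w.OnAisle q ∧ p.1 = q.1) ∨ (w.OnCross p ∧ w.OnCross q ∧ p.2 = q.2)

/-- `Route p q ℓ`: there is a walk of length `ℓ` from `p` to `q` through aisles and cross-aisles. -/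
inductive Route : Pt → Pt → ℝ → Prop
  | refl (p : Pt) (hp : w.Walkable p) : Route p p 0
  | cons (p q s : Pt) (ℓ : ℝ) (hpq : w.Straight p q) (hqs : Route q s ℓ) :
      Route p s (|p.1 - q.1| + |p.2 - q.2| + ℓ)

/-- The walking distance in the warehouse: the length of a shortest route. -/
def d (p q : Pt) : ℝ := sInf {ℓ | w.Route p q ℓ}

end Warehouse

/-- The three picking systems: pushcart with noninterventionist reoptimization, pushcart with
interventionist reoptimization, robot with interventionist reoptimization. -/
inductive PickingSystem
  | pcartN
  | pcart
  | robot

/-- An item to be collected: the index of its order and its picking location. -/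
abbrev Item (n : ℕ) := Fin n × Pt

/-- A picking tour: the items of a batch in the sequence in which they are collected. -/
abbrev Tour (n : ℕ) := List (Item n)

/-- The orders that occur in a tour. -/
def ordersOf {n : ℕ} (B : Tour n) : Finset (Fin n) := (B.map Prod.fst).toFinset

/-- The data of `n` orders: the sets of picking locations and the arrival times. -/
structure Instance (n : ℕ) where
  locs : Fin n → Finset Pt
  arr : Fin n → ℝ

namespace Instance

variable {n : ℕ} (I : Instance n)

/-- All items of the orders in `A`. -/
def itemsOf (A : Finset (Fin n)) : Set (Item n) := {x | x.1 ∈ A ∧ x.2 ∈ I.locs x.1}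

/-- The orders that have arrived by time `t`. -/
def arrived (t : ℝ) : Finset (Fin n) := Finset.univ.filter fun k => I.arr k ≤ t

/-- `k` is one of the first arrivals outside `A`. -/
def IsNext (A : Finset (Fin n)) (k : Fin n) : Prop := k ∉ A ∧ ∀ m, m ∉ A → I.arr k ≤ I.arr m

end Instance

section Planning

variable (w : Warehouse) (sys : PickingSystem) (c : ℕ)

/-- Where the picker ends a batch whose last item is at `p`: a pushcart has to be brought to the
depot, a robot leaves the picker where she is. -/
def batchEnd (p : Pt) : Pt :=
  match sys with
  | .pcartN => w.depot
  | .pcart => w.depot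
  | .robot => p

/-- Position and time after collecting the items of a tour, each as early as possible, starting at
the given position and time; an item cannot be collected before the arrival of its order. -/
def serve {n : ℕ} (arr : Fin n → ℝ) : Tour n → Pt × ℝ → Pt × ℝ
  | [], s => s
  | x :: B, s => serve arr B (x.2, max (s.2 + w.d s.1 x.2) (arr x.1))

/-- Position and time after serving a tour and ending the batch. -/
def serveBatch {n : ℕ} (arr : Fin n → ℝ) (s : Pt × ℝ) (B : Tour n) : Pt × ℝ :=
  let e := serve w arr B s
  (batchEnd w sys e.1, e.2 + w.d e.1 (batchEnd w sys e.1))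

/-- The time at which a sequence of batches is completed. -/
def completion {n : ℕ} (arr : Fin n → ℝ) (s : Pt × ℝ) (P : List (Tour n)) : ℝ :=
  (P.foldl (serveBatch w sys arr) s).2

/-- A solution for the set `Q` of items: a sequence of batches, each with at most `c` orders and with
a visiting sequence of its items, such that no order is split between batches. -/
structure IsPlan {n : ℕ} (Q : Set (Item n)) (P : List (Tour n)) : Prop where
  nodup : P.flatten.Nodup
  cover : ∀ x, x ∈ P.flatten ↔ x ∈ Q
  nonempty : ∀ B ∈ P, B ≠ []
  capacity : ∀ B ∈ P, (ordersOf B).card ≤ c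
  unsplit : P.Pairwise fun B B' => Disjoint (ordersOf B) (ordersOf B')

/-- The complete-information optimum: the least completion time, when all orders and their arrival
times are known in advance and the picker starts at the depot at time `0`. -/
def CIOPT {n : ℕ} (I : Instance n) : ℝ :=
  sInf {T | ∃ P, IsPlan c (I.itemsOf Finset.univ) P ∧ T = completion w sys I.arr (w.depot, 0) P}

/-! ### Noninterventionist reoptimization -/

/-- The picker is at the depot at time `time`; `plan` are the planned batches that have not been
started, `known` the orders that have been taken into account so far. -/
structure NState (n : ℕ) where
  time : ℝ
  plan : List (Tour n)
  known : Finset (Fin n)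

/-- `P` is an optimal solution for the items `Q`, all of them immediately available, from the depot. -/
def IsOptimalPlan {n : ℕ} (Q : Set (Item n)) (P : List (Tour n)) : Prop :=
  IsPlan c Q P ∧ ∀ P', IsPlan c Q P' →
    completion w sys (fun _ => 0) (w.depot, 0) P ≤ completion w sys (fun _ => 0) (w.depot, 0) P'

/-- One step of noninterventionist reoptimization with a pushcart. -/
inductive NStep {n : ℕ} (I : Instance n) : NState n → NState n → Prop
  /-- At the depot, with newly arrived orders: plan anew all arrived orders that are not picked. -/
  | reopt (s : NState n) (P : List (Tour n))
      (hnew : ∃ k, k ∉ s.known ∧ I.arr k ≤ s.time)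
      (hP : IsOptimalPlan w .pcartN c
        ({x | x ∈ s.plan.flatten} ∪ I.itemsOf (I.arrived s.time \ s.known)) P) :
      NStep I s ⟨s.time, P, I.arrived s.time⟩
  /-- Collect the next planned batch, without any intervention, and return to the depot. -/
  | batch (s : NState n) (B : Tour n) (P : List (Tour n)) (hs : s.plan = B :: P)
      (hold : ∀ k, k ∉ s.known → s.time ≤ I.arr k) :
      NStep I s ⟨completion w .pcartN (fun _ => 0) (w.depot, s.time) [B], P, s.known⟩
  /-- Nothing left to do: stay at the depot until the next arrival. -/
  | idle (s : NState n) (k : Fin n) (hs : s.plan = []) (hk : I.IsNext s.known k)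
      (ht : s.time < I.arr k) :
      NStep I s ⟨I.arr k, [], s.known⟩

/-- `T` is a completion time of noninterventionist reoptimization (for some choice among equally
good plans). -/
def IsNReopt {n : ℕ} (I : Instance n) (T : ℝ) : Prop :=
  Relation.ReflTransGen (NStep w c I) ⟨0, [], ∅⟩ ⟨T, [], Finset.univ⟩

/-! ### Interventionist reoptimization -/

/-- State of the interventionist policy: time, position of the picker, orders with picked items in
the current cart, remaining tour of the current batch, planned later batches, and the orders that
have been taken into account so far. -/
structure IState (n : ℕ) where
  time : ℝ
  pos : Pt
  cart : Finset (Fin n)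
  cur : Tour n
  fut : List (Tour n)
  known : Finset (Fin n)

/-- A feasible replanning for the unpicked items `Q` when the orders in `cart` occupy bins of the
current cart: those orders are completed in the current batch, whose remaining tour is `cur`, and
the empty bins can be given to any other orders. -/
structure IsReplan {n : ℕ} (cart : Finset (Fin n)) (Q : Set (Item n)) (cur : Tour n)
    (fut : List (Tour n)) : Prop where
  nodup : (cur ++ fut.flatten).Nodup
  cover : ∀ x, x ∈ cur ++ fut.flatten ↔ x ∈ Q
  commit : ∀ x ∈ Q, x.1 ∈ cart → x ∈ cur
  nonempty : ∀ B ∈ fut, B ≠ []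
  capacity_cur : (cart ∪ ordersOf cur).card ≤ c
  capacity_fut : ∀ B ∈ fut, (ordersOf B).card ≤ c
  unsplit : (cur :: fut).Pairwise fun B B' => Disjoint (ordersOf B) (ordersOf B')

/-- A feasible replanning that completes `Q` as early as possible from position `p`. -/
def IsOptimalReplan {n : ℕ} (p : Pt) (cart : Finset (Fin n)) (Q : Set (Item n)) (cur : Tour n)
    (fut : List (Tour n)) : Prop :=
  IsReplan c cart Q cur fut ∧ ∀ cur' fut', IsReplan c cart Q cur' fut' →
    completion w sys (fun _ => 0) (p, 0) (cur :: fut) ≤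
      completion w sys (fun _ => 0) (p, 0) (cur' :: fut')

namespace IState

variable {n : ℕ} (s : IState n)

/-- The next destination: the next item of the current tour, or the end of the current batch. -/
def dest : Pt :=
  match s.cur with
  | [] => batchEnd w sys s.pos
  | x :: _ => x.2

/-- Everything planned has been completed. -/
def Idle : Prop := s.cur = [] ∧ s.fut = [] ∧ s.cart = ∅ ∧ s.pos = batchEnd w sys s.pos

end IState

/-- One step of interventionist reoptimization. No step passes the arrival time of an order that
has not been taken into account. -/
inductive IStep {n : ℕ} (I : Instance n) : IState n → IState n → Prop
  /-- New orders have arrived: plan anew all arrived items that are not picked, from the current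
  position. -/
  | reopt (s : IState n) (cur : Tour n) (fut : List (Tour n))
      (hnew : ∃ k, k ∉ s.known ∧ I.arr k ≤ s.time)
      (hP : IsOptimalReplan w sys c s.pos s.cart
        ({x | x ∈ s.cur ++ s.fut.flatten} ∪ I.itemsOf (I.arrived s.time \ s.known)) cur fut) :
      IStep I s ⟨s.time, s.pos, s.cart, cur, fut, I.arrived s.time⟩
  /-- A new order arrives while the picker is on a shortest route to the next destination: at that
  moment she is at some point `p` of this route. -/
  | walk (s : IState n) (k : Fin n) (p : Pt) (hk : I.IsNext s.known k)
      (ht : s.time < I.arr k) (hd : I.arr k ≤ s.time + w.d s.pos (s.dest w sys))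
      (hp : w.Walkable p) (hp₁ : w.d s.pos p = I.arr k - s.time)
      (hp₂ : w.d s.pos p + w.d p (s.dest w sys) = w.d s.pos (s.dest w sys)) :
      IStep I s ⟨I.arr k, p, s.cart, s.cur, s.fut, s.known⟩
  /-- Collect the next item of the current tour. -/
  | pick (s : IState n) (x : Item n) (B : Tour n) (hs : s.cur = x :: B)
      (ht : ∀ k, k ∉ s.known → s.time + w.d s.pos x.2 ≤ I.arr k) :
      IStep I s ⟨s.time + w.d s.pos x.2, x.2, insert x.1 s.cart, B, s.fut, s.known⟩
  /-- End the current batch and turn to the next one. -/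
  | close (s : IState n) (hs : s.cur = []) (hni : ¬ s.Idle w sys)
      (ht : ∀ k, k ∉ s.known → s.time + w.d s.pos (batchEnd w sys s.pos) ≤ I.arr k) :
      IStep I s ⟨s.time + w.d s.pos (batchEnd w sys s.pos), batchEnd w sys s.pos, ∅,
        s.fut.headD [], s.fut.tail, s.known⟩
  /-- Nothing left to do: stay until the next arrival. -/
  | idle (s : IState n) (k : Fin n) (hs : s.Idle w sys) (hk : I.IsNext s.known k)
      (ht : s.time < I.arr k) :
      IStep I s ⟨I.arr k, s.pos, s.cart, s.cur, s.fut, s.known⟩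

/-- `T` is a completion time of interventionist reoptimization (for some choice among equally good
plans and among shortest routes). -/
def IsIReopt {n : ℕ} (I : Instance n) (T : ℝ) : Prop :=
  ∃ s : IState n, Relation.ReflTransGen (IStep w sys c I) ⟨0, w.depot, ∅, [], [], ∅⟩ s ∧
    s.Idle w sys ∧ s.known = Finset.univ ∧ s.time = T

/-- `T` is a value of `Reopt(I)` in the given picking system. -/
def IsReopt {n : ℕ} (I : Instance n) (T : ℝ) : Prop :=
  match sys with
  | .pcartN => IsNReopt w c I T
  | .pcart => IsIReopt w .pcart c I T
  | .robot => IsIReopt w .robot c I T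

end Planning

/-! ### Random instances -/

/-- An order as a tuple `(K, S¹, …, S^K)`; this type carries the sum of the product σ-algebras. -/
abbrev OrderTuple := Σ k : ℕ, Fin k → Pt

/-- The set of picking locations of an order. -/
def locSet (o : OrderTuple) : Finset Pt := Finset.univ.image o.2

/-- At least one picking location, and all of them in aisles. -/
def IsOrder (w : Warehouse) (o : OrderTuple) : Prop := 1 ≤ o.1 ∧ ∀ i, w.OnAisle (o.2 i)

/-- The values `y 0, …, y (n-1)` in nondecreasing order. -/
def orderStat (n : ℕ) (y : ℕ → ℝ) : Fin n → ℝ :=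
  (fun i : Fin n => y i) ∘ Tuple.sort (fun i : Fin n => y i)

/-- The instance with the first `n` orders, the `j`-th of which arrives at the `j`-th order statistic
of the first `n` times. -/
def mkInstance (n : ℕ) (o : ℕ → OrderTuple) (y : ℕ → ℝ) : Instance n where
  locs j := locSet (o j)
  arr := orderStat n y

end OrderPicking

end

/-! Reoptimization exceeds the optimum by o(n), while the optimum grows linearly in n. With R the
last arrival time, CIOPT ≤ Reopt ≤ CIOPT + R + C, where C depends on the warehouse only.

The left inequality holds because the batches that the policy executes form a plan respecting the
arrival times (`NInvariant`, `IInvariant`). For the right one, consider the last replanning. Any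
complete-information plan, restricted to the unpicked items and freed of its waiting times, competes
with the new plan; by the triangle inequality, skipping a stop never delays a walk
(`Dominates.foldl_restrict`). The other costs are bounded, since the items of any batch can be
collected in one sweep of bounded length (`exists_tour_bound`). For `pcartN` this bounds the batch
that delays the last replanning; for the interventionist systems it bounds the completion of the
current cart. The result is `exists_isReopt_le`.

For the growth, an order that forces a walk of length δ makes its batch last at least δ, and a batch
holds at most c orders, so CIOPT is at least δ/c times the number of such orders
(`sum_le_mul_ciopt`). For some δ > 0 they have positive probability (`exists_needsTime`), hence
positive asymptotic frequency by the strong law (`exists_linear_growth`). The finite mean of the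
arrival variables gives R = o(n) (`eventually_forall_lt_le`). There remains a pushcart with all
locations at the depot: then policy and optimum both equal R (`tendsto_ratio_of_depot`). -/

namespace OrderPicking

namespace Warehouse

variable {w : Warehouse}

theorem Straight.symm {p q : Pt} (h : w.Straight p q) : w.Straight q p := by
  rcases h with ⟨h₁, h₂, h⟩ | ⟨h₁, h₂, h⟩
  · exact Or.inl ⟨h₂, h₁, h.symm⟩
  · exact Or.inr ⟨h₂, h₁, h.symm⟩

theorem Straight.walkable_left {p q : Pt} (h : w.Straight p q) : w.Walkable p := by
  rcases h with ⟨h₁, -, -⟩ | ⟨h₁, -, -⟩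
  · exact Or.inl h₁
  · exact Or.inr h₁

theorem Straight.walkable_right {p q : Pt} (h : w.Straight p q) : w.Walkable q :=
  h.symm.walkable_left

theorem Straight.route {p q : Pt} (h : w.Straight p q) :
    w.Route p q (|p.1 - q.1| + |p.2 - q.2|) := by
  simpa using Route.cons p q q 0 h (Route.refl q h.walkable_right)

theorem Route.trans {p q s : Pt} {ℓ m : ℝ} (h : w.Route p q ℓ) (h' : w.Route q s m) :
    w.Route p s (ℓ + m) := by
  induction h with
  | refl p hp => simpa using h'
  | cons p q r ℓ hpq _ ih => simpa [add_assoc] using Route.cons p q s _ hpq (ih h')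

theorem Route.l1_le {p q : Pt} {ℓ : ℝ} (h : w.Route p q ℓ) :
    |p.1 - q.1| + |p.2 - q.2| ≤ ℓ := by
  induction h with
  | refl p hp => simp
  | cons p q r ℓ hpq _ ih =>
    have h₁ := abs_sub_le p.1 q.1 r.1
    have h₂ := abs_sub_le p.2 q.2 r.2
    linarith

theorem Route.nonneg {p q : Pt} {ℓ : ℝ} (h : w.Route p q ℓ) : 0 ≤ ℓ :=
  le_trans (by positivity) h.l1_le

theorem Route.walkable_left {p q : Pt} {ℓ : ℝ} (h : w.Route p q ℓ) : w.Walkable p := by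
  cases h with
  | refl _ hp => exact hp
  | cons _ _ _ _ hpq _ => exact hpq.walkable_left

variable (w)

theorem walkable_depot : w.Walkable w.depot := w.depot_mem

theorem OnAisle.fst_mem {w : Warehouse} {p : Pt} (h : w.OnAisle p) : 0 ≤ p.1 ∧ p.1 ≤ w.len := by
  obtain ⟨⟨i, hi, hp⟩, -⟩ := h
  have hL := w.len_nonneg
  have ha : (i : ℝ) ≤ (w.a : ℝ) - 1 := by
    have : (i : ℝ) + 1 ≤ w.a := by exact_mod_cast hi
    linarith
  have h0 : (0 : ℝ) ≤ (w.a : ℝ) - 1 := le_trans (by positivity) ha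
  rw [hp]
  refine ⟨by positivity, ?_⟩
  rcases h0.eq_or_lt with h | h
  · simpa [← h] using hL
  · rw [mul_div_assoc', div_le_iff₀ h]
    nlinarith

theorem OnCross.snd_mem {w : Warehouse} {p : Pt} (h : w.OnCross p) : 0 ≤ p.2 ∧ p.2 ≤ w.wid := by
  obtain ⟨⟨i, hi, hp⟩, -⟩ := h
  have hL := w.wid_nonneg
  have ha : (i : ℝ) ≤ (w.b : ℝ) - 1 := by
    have : (i : ℝ) + 1 ≤ w.b := by exact_mod_cast hi
    linarith
  have h0 : (0 : ℝ) ≤ (w.b : ℝ) - 1 := le_trans (by positivity) ha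
  rw [hp]
  refine ⟨by positivity, ?_⟩
  rcases h0.eq_or_lt with h | h
  · simpa [← h] using hL
  · rw [mul_div_assoc', div_le_iff₀ h]
    nlinarith

theorem onAisle_zero {y : ℝ} (h : 0 ≤ y) (h' : y ≤ w.wid) : w.OnAisle (0, y) :=
  ⟨⟨0, w.one_le_a, by simp⟩, h, h'⟩

theorem onCross_zero {x : ℝ} (h : 0 ≤ x) (hx : x ≤ w.len) : w.OnCross (x, 0) :=
  ⟨⟨0, lt_of_lt_of_le (by norm_num) w.two_le_b, by simp⟩, h, hx⟩

/-- Every position has a corner point of some aisle in line with it, from which the origin can be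
reached in a straight walk. -/
theorem exists_corner {p : Pt} (hp : w.Walkable p) :
    ∃ q, w.Straight p q ∧ w.Straight q (0, 0) ∧
      |p.1 - q.1| + |p.2 - q.2| + (|q.1| + |q.2|) ≤ w.len + w.wid := by
  rcases hp with hp | hp
  · have hx := hp.fst_mem
    obtain ⟨hi, hy⟩ := id hp
    refine ⟨(p.1, 0), Or.inl ⟨hp, ⟨hi, le_rfl, w.wid_nonneg⟩, rfl⟩,
      Or.inr ⟨w.onCross_zero hx.1 hx.2, w.onCross_zero le_rfl w.len_nonneg, rfl⟩, ?_⟩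
    simp only [sub_self, abs_zero, sub_zero, abs_of_nonneg hx.1, abs_of_nonneg hy.1]
    linarith [hx.2, hy.2]
  · have hy := hp.snd_mem
    obtain ⟨hi, hx⟩ := id hp
    refine ⟨(0, p.2), Or.inr ⟨hp, ⟨hi, le_rfl, w.len_nonneg⟩, rfl⟩,
      Or.inl ⟨w.onAisle_zero hy.1 hy.2, w.onAisle_zero le_rfl w.wid_nonneg, rfl⟩, ?_⟩
    simp only [sub_self, abs_zero, sub_zero, abs_of_nonneg hx.1, abs_of_nonneg hy.1]
    linarith [hx.2, hy.2]

/-- Both points are joined to the origin through their corners, at a cost of at most `len + wid`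
each. -/
theorem exists_route {p q : Pt} (hp : w.Walkable p) (hq : w.Walkable q) :
    ∃ ℓ, w.Route p q ℓ ∧ ℓ ≤ 2 * (w.len + w.wid) := by
  obtain ⟨p', h₁, h₂, hl⟩ := w.exists_corner hp
  obtain ⟨q', h₃, h₄, hl'⟩ := w.exists_corner hq
  refine ⟨_, ((h₁.route.trans h₂.route).trans h₄.symm.route).trans h₃.symm.route, ?_⟩
  simp only [sub_zero, zero_sub, abs_neg]
  rw [abs_sub_comm q'.1, abs_sub_comm q'.2]
  linarith

theorem bddBelow_route (p q : Pt) : BddBelow {ℓ | w.Route p q ℓ} :=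
  ⟨0, fun _ h => h.nonneg⟩

variable {w}

theorem Route.d_le {p q : Pt} {ℓ : ℝ} (h : w.Route p q ℓ) : w.d p q ≤ ℓ :=
  csInf_le (w.bddBelow_route p q) h

theorem Straight.d_le {p q : Pt} (h : w.Straight p q) :
    w.d p q ≤ |p.1 - q.1| + |p.2 - q.2| := h.route.d_le

variable (w)

theorem d_nonneg (p q : Pt) : 0 ≤ w.d p q := Real.sInf_nonneg fun _ h => Route.nonneg h

@[simp] theorem d_self (p : Pt) : w.d p p = 0 := by
  by_cases hp : w.Walkable p
  · exact le_antisymm (Route.refl p hp).d_le (w.d_nonneg p p)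
  -- No route starts outside the aisles and cross-aisles, and the infimum of the empty set is 0 in
  -- ℝ.
  · have : {ℓ | w.Route p p ℓ} = ∅ :=
      Set.eq_empty_of_forall_notMem fun ℓ h => hp (Route.walkable_left h)
    rw [d, this, Real.sInf_empty]

theorem d_le_diam {p q : Pt} (hp : w.Walkable p) (hq : w.Walkable q) :
    w.d p q ≤ 2 * (w.len + w.wid) := by
  obtain ⟨ℓ, h, hl⟩ := w.exists_route hp hq
  exact h.d_le.trans hl

theorem l1_le_d {p q : Pt} (hp : w.Walkable p) (hq : w.Walkable q) :
    |p.1 - q.1| + |p.2 - q.2| ≤ w.d p q := by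
  obtain ⟨ℓ, h, -⟩ := w.exists_route hp hq
  exact le_csInf ⟨ℓ, h⟩ fun _ h => Route.l1_le h

/-- Lower bounds for walks can thus be stated with the sup metric of the plane, for which distinct
points have positive distance and measurability is immediate. -/
theorem dist_le_d {p q : Pt} (hp : w.Walkable p) (hq : w.Walkable q) : dist p q ≤ w.d p q := by
  refine le_trans ?_ (w.l1_le_d hp hq)
  rw [Prod.dist_eq, Real.dist_eq, Real.dist_eq]
  exact max_le (by linarith [abs_nonneg (p.2 - q.2)]) (by linarith [abs_nonneg (p.1 - q.1)])

theorem exists_route_lt {p q : Pt} (hp : w.Walkable p) (hq : w.Walkable q) {ε : ℝ} (hε : 0 < ε) :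
    ∃ ℓ, w.Route p q ℓ ∧ ℓ < w.d p q + ε := by
  obtain ⟨ℓ, h, -⟩ := w.exists_route hp hq
  exact exists_lt_of_csInf_lt ⟨ℓ, h⟩ (lt_add_of_pos_right _ hε)

theorem d_triangle {p q s : Pt} (hp : w.Walkable p) (hq : w.Walkable q) (hs : w.Walkable s) :
    w.d p s ≤ w.d p q + w.d q s := by
  refine le_of_forall_pos_le_add fun ε hε => ?_
  obtain ⟨ℓ, h, hl⟩ := w.exists_route_lt hp hq (half_pos hε)
  obtain ⟨m, h', hm⟩ := w.exists_route_lt hq hs (half_pos hε)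
  have := (h.trans h').d_le
  linarith

/-- The point that divides the segment from `p` to `q` in the ratio `r : 1 - r`. -/
theorem Straight.divide {w : Warehouse} {p q : Pt} (h : w.Straight p q) {r : ℝ} (h0 : 0 ≤ r)
    (h1 : r ≤ 1) :
    w.Straight p (p.1 + r * (q.1 - p.1), p.2 + r * (q.2 - p.2)) ∧
      w.Straight (p.1 + r * (q.1 - p.1), p.2 + r * (q.2 - p.2)) q := by
  rcases h with ⟨⟨hi, hp, hp'⟩, ⟨hi', hq, hq'⟩, h⟩ | ⟨⟨hi, hp, hp'⟩, ⟨hi', hq, hq'⟩, h⟩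
  · have key : w.OnAisle (p.1 + r * (q.1 - p.1), p.2 + r * (q.2 - p.2)) := by
      refine ⟨by simpa [h] using hi', ?_, ?_⟩ <;> dsimp only <;> nlinarith
    exact ⟨Or.inl ⟨⟨hi, hp, hp'⟩, key, by simp [h]⟩, Or.inl ⟨key, ⟨hi', hq, hq'⟩, by simp [h]⟩⟩
  · have key : w.OnCross (p.1 + r * (q.1 - p.1), p.2 + r * (q.2 - p.2)) := by
      refine ⟨by simpa [h] using hi', ?_, ?_⟩ <;> dsimp only <;> nlinarith
    exact ⟨Or.inr ⟨⟨hi, hp, hp'⟩, key, by simp [h]⟩, Or.inr ⟨key, ⟨hi', hq, hq'⟩, by simp [h]⟩⟩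

/-- A route can be divided at any length. -/
theorem Route.divide {w : Warehouse} {p q : Pt} {ℓ : ℝ} (h : w.Route p q ℓ) {t : ℝ} (h0 : 0 ≤ t)
    (ht : t ≤ ℓ) : ∃ m, w.Route p m t ∧ w.Route m q (ℓ - t) := by
  induction h generalizing t with
  | refl p hp =>
    obtain rfl : t = 0 := le_antisymm ht h0
    exact ⟨p, Route.refl p hp, by simpa using Route.refl p hp⟩
  | cons p q s ℓ hpq hqs ih =>
    set e := |p.1 - q.1| + |p.2 - q.2| with he
    have he0 : 0 ≤ e := by positivity
    by_cases hte : t < e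
    · have hepos : 0 < e := h0.trans_lt hte
      have hr0 : 0 ≤ t / e := by positivity
      have hr1 : t / e ≤ 1 := (div_le_one hepos).2 hte.le
      obtain ⟨h₁, h₂⟩ := hpq.divide hr0 hr1
      refine ⟨(p.1 + t / e * (q.1 - p.1), p.2 + t / e * (q.2 - p.2)), ?_, ?_⟩
      · convert h₁.route using 1
        simp only [sub_add_cancel_left, abs_neg, abs_mul, abs_of_nonneg hr0]
        rw [abs_sub_comm q.1, abs_sub_comm q.2, ← mul_add, ← he]
        field_simp
      · have := h₂.route.trans hqs
        convert this using 1
        have e1 : ∀ x y : ℝ, |x + t / e * (y - x) - y| = (1 - t / e) * |x - y| := fun x y => by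
          rw [← abs_of_nonneg (sub_nonneg.2 hr1), ← abs_mul]
          ring_nf
        simp only [e1]
        rw [← mul_add, ← he]
        field_simp
        ring
    · obtain ⟨m, h₁, h₂⟩ := ih (t := t - e) (by linarith) (by linarith)
      refine ⟨m, ?_, ?_⟩
      · have := Route.cons p q m _ hpq h₁
        rwa [← he, add_sub_cancel] at this
      · convert h₂ using 1
        ring

/-- Every sequence of walkable points clusters, in the walking distance, at a walkable point. -/
theorem exists_cluster (m : ℕ → Pt) (hm : ∀ N, w.Walkable (m N)) :
    ∃ p, w.Walkable p ∧ ∀ ε > 0, ∃ᶠ N in atTop, w.d (m N) p < ε ∧ w.d p (m N) < ε := by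
  -- An ultrafilter selects a single aisle or cross-aisle containing almost all of the points. Its
  -- compactness gives a limit on the same segment, so the walks to the limit are straight and
  -- convergence in the plane becomes convergence in `d`.
  let U : Ultrafilter ℕ := Filter.hyperfilter ℕ
  have hU : (U : Filter ℕ) ≤ atTop := Nat.hyperfilter_le_atTop
  suffices h : ∃ p, w.Walkable p ∧ Tendsto m U (𝓝 p) ∧ ∀ᶠ N in (U : Filter ℕ), w.Straight (m N) p by
    obtain ⟨p, hp, hlim, hstr⟩ := h
    refine ⟨p, hp, fun ε hε => ?_⟩
    have h1 : Tendsto (fun N => |(m N).1 - p.1| + |(m N).2 - p.2|) U (𝓝 0) := by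
      have hc : Continuous fun q : Pt => |q.1 - p.1| + |q.2 - p.2| := by fun_prop
      simpa [Function.comp_def] using (hc.tendsto p).comp hlim
    have h2 : ∀ᶠ N in (U : Filter ℕ), w.d (m N) p < ε ∧ w.d p (m N) < ε := by
      filter_upwards [h1.eventually (gt_mem_nhds hε), hstr] with N hN hs
      refine ⟨hs.d_le.trans_lt hN, hs.symm.d_le.trans_lt ?_⟩
      rwa [abs_sub_comm p.1, abs_sub_comm p.2]
    exact h2.frequently.filter_mono hU
  have hcases : ∀ᶠ N in (U : Filter ℕ), w.OnAisle (m N) ∨ w.OnCross (m N) :=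
    Eventually.of_forall hm
  rcases Ultrafilter.eventually_or.1 hcases with h | h
  · have h' : (⋃ i ∈ Set.Iio w.a,
      m ⁻¹' ({(i : ℝ) * (w.len / (w.a - 1))} ×ˢ Set.Icc 0 w.wid)) ∈ U := by
      filter_upwards [h] with N hN
      obtain ⟨⟨i, hi, hx⟩, hy⟩ := hN
      exact Set.mem_biUnion hi ⟨hx, hy⟩
    obtain ⟨i, hi, hiU⟩ := (Ultrafilter.finite_biUnion_mem_iff (Set.finite_Iio w.a)).1 h'
    have hcomp : IsCompact (({(i : ℝ) * (w.len / (w.a - 1))} : Set ℝ) ×ˢ Set.Icc 0 w.wid) :=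
      isCompact_singleton.prod isCompact_Icc
    obtain ⟨p, hp, hlim⟩ := hcomp.ultrafilter_le_nhds' (U.map m) hiU
    have hpa : w.OnAisle p := ⟨⟨i, hi, hp.1⟩, hp.2⟩
    refine ⟨p, Or.inl hpa, hlim, ?_⟩
    filter_upwards [hiU] with N hN
    exact Or.inl ⟨⟨⟨i, hi, hN.1⟩, hN.2⟩, hpa, hN.1.trans hp.1.symm⟩
  · have h' : (⋃ i ∈ Set.Iio w.b,
      m ⁻¹' (Set.Icc 0 w.len ×ˢ {(i : ℝ) * (w.wid / (w.b - 1))})) ∈ U := by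
      filter_upwards [h] with N hN
      obtain ⟨⟨i, hi, hx⟩, hy⟩ := hN
      exact Set.mem_biUnion hi ⟨hy, hx⟩
    obtain ⟨i, hi, hiU⟩ := (Ultrafilter.finite_biUnion_mem_iff (Set.finite_Iio w.b)).1 h'
    have hcomp : IsCompact (Set.Icc 0 w.len ×ˢ ({(i : ℝ) * (w.wid / (w.b - 1))} : Set ℝ)) :=
      isCompact_Icc.prod isCompact_singleton
    obtain ⟨p, hp, hlim⟩ := hcomp.ultrafilter_le_nhds' (U.map m) hiU
    have hpa : w.OnCross p := ⟨⟨i, hi, hp.2⟩, hp.1⟩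
    refine ⟨p, Or.inr hpa, hlim, ?_⟩
    filter_upwards [hiU] with N hN
    exact Or.inr ⟨⟨⟨i, hi, hN.2⟩, hN.1⟩, hpa, hN.2.trans hp.2.symm⟩

/-- The walking distance is a geodesic metric. -/
theorem exists_between {p q : Pt} (hp : w.Walkable p) (hq : w.Walkable q) {t : ℝ} (h0 : 0 ≤ t)
    (ht : t ≤ w.d p q) :
    ∃ m, w.Walkable m ∧ w.d p m = t ∧ w.d p m + w.d m q = w.d p q := by
  -- The infimum defining `d` is not known to be attained: almost shortest routes are divided at
  -- length `t`, and a cluster point of the division points removes the error.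
  have hex : ∀ N : ℕ, ∃ m, w.Walkable m ∧ w.d p m ≤ t ∧
      w.d m q ≤ w.d p q - t + 1 / ((N : ℝ) + 1) := fun N => by
    obtain ⟨ℓ, h, hl⟩ := w.exists_route_lt hp hq (Nat.one_div_pos_of_nat (n := N) (α := ℝ))
    obtain ⟨m, h₁, h₂⟩ := h.divide h0 (ht.trans h.d_le)
    exact ⟨m, h₂.walkable_left, h₁.d_le, h₂.d_le.trans (by linarith)⟩
  choose m hm hpm hmq using hex
  obtain ⟨x, hx, hclus⟩ := w.exists_cluster m hm
  have h1 : w.d p x ≤ t := le_of_forall_pos_le_add fun ε hε => by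
    obtain ⟨N, hN⟩ := (hclus ε hε).exists
    linarith [w.d_triangle hp (hm N) hx, hpm N, hN.1]
  have h2 : w.d x q ≤ w.d p q - t := le_of_forall_pos_le_add fun ε hε => by
    have hev : ∀ᶠ N : ℕ in atTop, 1 / ((N : ℝ) + 1) < ε / 2 :=
      tendsto_one_div_add_atTop_nhds_zero_nat.eventually (gt_mem_nhds (half_pos hε))
    obtain ⟨N, hN, hN'⟩ := ((hclus (ε / 2) (half_pos hε)).and_eventually hev).exists
    linarith [w.d_triangle hx (hm N) hq, hmq N, hN.2]
  have h3 := w.d_triangle hp hx hq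
  exact ⟨x, hx, by linarith, by linarith⟩

/-- Along this potential the aisles are traversed one after the other. -/
theorem exists_potential : ∃ (φ : Pt → ℝ) (M : ℝ), 0 ≤ M ∧ (∀ p, w.OnAisle p → 0 ≤ φ p ∧ φ p ≤ M) ∧
    ∀ p q, w.OnAisle p → w.OnAisle q → φ p ≤ φ q → w.d p q ≤ φ q - φ p := by
  classical
  set D := 2 * (w.len + w.wid) with hD
  have hD0 : 0 ≤ D := by have := w.len_nonneg; have := w.wid_nonneg; positivity
  have hw := w.wid_nonneg
  let i : Pt → ℕ := fun p => if h : w.OnAisle p then h.1.choose else 0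
  have hi : ∀ p, w.OnAisle p → i p < w.a ∧ p.1 = i p * (w.len / (w.a - 1)) := fun p h => by
    simp only [i, dif_pos h]
    exact h.1.choose_spec
  -- Moving to a later aisle loses at most `wid` in the second coordinate, so the potential still
  -- rises by at least `D + 1`, more than any distance. Within one aisle it rises by the distance
  -- itself.
  refine ⟨fun p => i p * (w.wid + D + 1) + p.2, w.a * (w.wid + D + 1) + w.wid, by positivity,
    fun p hp => ⟨?_, ?_⟩, fun p q hp hq hpq => ?_⟩
  · have := hp.2.1
    positivity
  · have h1 : (i p : ℝ) ≤ w.a := by exact_mod_cast (hi p hp).1.le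
    have h2 : (i p : ℝ) * (w.wid + D + 1) ≤ w.a * (w.wid + D + 1) := by gcongr
    linarith [hp.2.2]
  · dsimp only at hpq ⊢
    have hp' := hp.2
    have hq' := hq.2
    rcases lt_trichotomy (i p) (i q) with h | h | h
    · have h1 : (i p : ℝ) + 1 ≤ i q := by exact_mod_cast h
      have h2 := w.d_le_diam (Or.inl hp) (Or.inl hq)
      nlinarith
    · have hx : p.1 = q.1 := by rw [(hi p hp).2, (hi q hq).2, h]
      have h2 := Straight.d_le (w := w) (Or.inl ⟨hp, hq, hx⟩)
      rw [h] at hpq ⊢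
      rw [hx, sub_self, abs_zero, abs_of_nonpos (by linarith)] at h2
      linarith
    · exfalso
      have h1 : (i q : ℝ) + 1 ≤ i p := by exact_mod_cast h
      nlinarith

end Warehouse

/-! ### Walks along tours -/

section Serving

variable {w : Warehouse} {sys : PickingSystem} {n : ℕ} {arr : Fin n → ℝ}

theorem walkable_batchEnd {p : Pt} (hp : w.Walkable p) : w.Walkable (batchEnd w sys p) := by
  cases sys
  exacts [w.walkable_depot, w.walkable_depot, hp]

theorem batchEnd_batchEnd (p : Pt) :
    batchEnd w sys (batchEnd w sys p) = batchEnd w sys p := by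
  cases sys <;> rfl

/-- For a pushcart this is the triangle inequality through `q`; for a robot both sides are `d p q`.
It lets a lead survive the end of a batch. -/
theorem d_batchEnd_add_le {p q : Pt} (hp : w.Walkable p) (hq : w.Walkable q) :
    w.d p (batchEnd w sys p) + w.d (batchEnd w sys p) (batchEnd w sys q) ≤
      w.d p q + w.d q (batchEnd w sys q) := by
  cases sys
  · simpa [batchEnd] using w.d_triangle hp hq w.walkable_depot
  · simpa [batchEnd] using w.d_triangle hp hq w.walkable_depot
  · simp [batchEnd]

theorem serve_append (B B' : Tour n) (s : Pt × ℝ) :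
    serve w arr (B ++ B') s = serve w arr B' (serve w arr B s) := by
  induction B generalizing s with
  | nil => rfl
  | cons x B ih => exact ih _

theorem walkable_serve {B : Tour n} (hB : ∀ x ∈ B, w.Walkable x.2) {s : Pt × ℝ}
    (hs : w.Walkable s.1) : w.Walkable (serve w arr B s).1 := by
  induction B generalizing s with
  | nil => exact hs
  | cons x B ih => exact ih (fun y hy => hB y (by simp [hy])) (hB x (by simp))

theorem walkable_serveBatch {B : Tour n} (hB : ∀ x ∈ B, w.Walkable x.2) {s : Pt × ℝ}
    (hs : w.Walkable s.1) : w.Walkable (serveBatch w sys arr s B).1 :=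
  walkable_batchEnd (walkable_serve hB hs)

theorem le_serve (B : Tour n) (s : Pt × ℝ) : s.2 ≤ (serve w arr B s).2 := by
  induction B generalizing s with
  | nil => exact le_rfl
  | cons x B ih =>
    refine le_trans ?_ (ih _)
    exact le_max_of_le_left (by linarith [w.d_nonneg s.1 x.2])

theorem le_serveBatch (B : Tour n) (s : Pt × ℝ) : s.2 ≤ (serveBatch w sys arr s B).2 :=
  (le_serve B s).trans (le_add_of_nonneg_right (w.d_nonneg _ _))

theorem le_foldl_serveBatch (P : List (Tour n)) (s : Pt × ℝ) :
    s.2 ≤ (P.foldl (serveBatch w sys arr) s).2 := by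
  induction P generalizing s with
  | nil => exact le_rfl
  | cons B P ih => exact (le_serveBatch B s).trans (ih _)

theorem arr_le_serve {B : Tour n} {x : Item n} (hx : x ∈ B) (s : Pt × ℝ) :
    arr x.1 ≤ (serve w arr B s).2 := by
  induction B generalizing s with
  | nil => simp at hx
  | cons y B ih =>
    rcases List.mem_cons.1 hx with rfl | hx
    · exact (le_max_right (s.2 + w.d s.1 x.2) (arr x.1)).trans (le_serve B (x.2, _))
    · exact ih hx _

theorem arr_le_completion {P : List (Tour n)} {x : Item n} (hx : x ∈ P.flatten) (s : Pt × ℝ) :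
    arr x.1 ≤ completion w sys arr s P := by
  induction P generalizing s with
  | nil => simp at hx
  | cons B P ih =>
    rw [List.flatten_cons, List.mem_append] at hx
    rcases hx with hx | hx
    · have h1 : (serve w arr B s).2 ≤ (serveBatch w sys arr s B).2 :=
        le_add_of_nonneg_right (w.d_nonneg _ _)
      exact ((arr_le_serve hx s).trans h1).trans (le_foldl_serveBatch P _)
    · exact ih hx _

theorem completion_nonneg (P : List (Tour n)) (p : Pt) : 0 ≤ completion w sys arr (p, 0) P :=
  le_foldl_serveBatch P (p, 0)

/-! ### Orders without waiting times -/

theorem serve_eq_of_arrived {B : Tour n} {s : Pt × ℝ} (h0 : 0 ≤ s.2)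
    (h : ∀ x ∈ B, arr x.1 ≤ s.2) : serve w arr B s = serve w (fun _ => 0) B s := by
  induction B generalizing s with
  | nil => rfl
  | cons x B ih =>
    have hd := w.d_nonneg s.1 x.2
    have h1 : max (s.2 + w.d s.1 x.2) (arr x.1) = s.2 + w.d s.1 x.2 :=
      max_eq_left (by linarith [h x (by simp)])
    have h2 : max (s.2 + w.d s.1 x.2) 0 = s.2 + w.d s.1 x.2 := max_eq_left (by linarith)
    simp only [serve, h1, h2]
    exact ih (by dsimp only; linarith) fun y hy => by
      have := h y (by simp [hy])
      dsimp only
      linarith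

/-- At nonnegative times the maximum with the arrival time 0 has no effect, so walks are invariant
under time shifts. Plans are compared from time 0 but executed at the current time. -/
theorem serve_zero_shift (B : Tour n) (p : Pt) {t u : ℝ} (ht : 0 ≤ t) (hu : 0 ≤ u) :
    serve w (fun _ : Fin n => 0) B (p, t + u) =
      ((serve w (fun _ => 0) B (p, t)).1, (serve w (fun _ => 0) B (p, t)).2 + u) := by
  induction B generalizing p t with
  | nil => rfl
  | cons x B ih =>
    have hd := w.d_nonneg p x.2
    simp only [serve]
    rw [max_eq_left (by positivity), max_eq_left (by positivity), add_right_comm, ih]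
    positivity

theorem foldl_zero_shift (P : List (Tour n)) (p : Pt) {t u : ℝ} (ht : 0 ≤ t) (hu : 0 ≤ u) :
    P.foldl (serveBatch w sys fun _ => 0) (p, t + u) =
      ((P.foldl (serveBatch w sys fun _ => 0) (p, t)).1,
        (P.foldl (serveBatch w sys fun _ => 0) (p, t)).2 + u) := by
  induction P generalizing p t with
  | nil => rfl
  | cons B P ih =>
    have h : serveBatch w sys (fun _ => 0) (p, t + u) B =
        ((serveBatch w sys (fun _ => 0) (p, t) B).1,
          (serveBatch w sys (fun _ => 0) (p, t) B).2 + u) := by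
      simp only [serveBatch, serve_zero_shift B p ht hu]
      rw [add_right_comm]
    rw [List.foldl_cons, h, ih]
    · rfl
    · exact ht.trans (le_serveBatch B (p, t))

theorem completion_zero_shift (P : List (Tour n)) (p : Pt) {t u : ℝ} (ht : 0 ≤ t) (hu : 0 ≤ u) :
    completion w sys (fun _ => 0) (p, t + u) P = completion w sys (fun _ => 0) (p, t) P + u := by
  rw [completion, foldl_zero_shift P p ht hu]
  rfl

theorem completion_zero_eq_add (P : List (Tour n)) (p : Pt) {u : ℝ} (hu : 0 ≤ u) :
    completion w sys (fun _ => 0) (p, u) P = completion w sys (fun _ => 0) (p, 0) P + u := by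
  rw [← completion_zero_shift P p le_rfl hu, zero_add]

theorem serve_of_forall_eq {p : Pt} {B : Tour n} (hB : ∀ x ∈ B, x.2 = p) {t : ℝ} (ht : 0 ≤ t) :
    serve w (fun _ => 0) B (p, t) = (p, t) := by
  induction B with
  | nil => rfl
  | cons x B ih =>
    have hx : x.2 = p := hB x (by simp)
    simp only [serve, hx, Warehouse.d_self, add_zero, max_eq_left ht]
    exact ih fun y hy => hB y (by simp [hy])

/-! ### Comparison of walks -/

variable (w) in
/-- From `s` one can reach the position of `s'` with a delay of at most `u`. -/
structure Dominates (u : ℝ) (s s' : Pt × ℝ) : Prop where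
  left : w.Walkable s.1
  right : w.Walkable s'.1
  le : s.2 + w.d s.1 s'.1 ≤ s'.2 + u

theorem Dominates.refl {s : Pt × ℝ} (hs : w.Walkable s.1) : Dominates w 0 s s :=
  ⟨hs, hs, by simp⟩

theorem Dominates.time_le {u : ℝ} {s s' : Pt × ℝ} (h : Dominates w u s s') : s.2 ≤ s'.2 + u := by
  linarith [h.le, w.d_nonneg s.1 s'.1]

variable {arr' : Fin n → ℝ} {u : ℝ}

/-- At a kept item both walkers meet, and waiting is covered by the slack `u` between the arrival
times. At a skipped item the left walker stays, and the triangle inequality preserves the bound. -/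
theorem Dominates.serve_filter (harr : ∀ k, arr k ≤ arr' k + u) (f : Item n → Bool) {B : Tour n}
    (hB : ∀ x ∈ B, w.Walkable x.2) {s s' : Pt × ℝ} (h : Dominates w u s s') :
    Dominates w u (serve w arr (B.filter f) s) (serve w arr' B s') := by
  induction B generalizing s s' with
  | nil => exact h
  | cons x B ih =>
    have hx := hB x (by simp)
    have htri := w.d_triangle h.left h.right hx
    have hle := h.le
    rw [List.filter_cons]
    split_ifs
    · refine ih (fun y hy => hB y (by simp [hy])) ⟨hx, hx, ?_⟩
      simp only [Warehouse.d_self, add_zero]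
      refine max_le ?_ ((harr x.1).trans (by gcongr; exact le_max_right _ _))
      linarith [le_max_left (s'.2 + w.d s'.1 x.2) (arr' x.1)]
    · refine ih (fun y hy => hB y (by simp [hy])) ⟨h.left, hx, ?_⟩
      dsimp only
      linarith [le_max_left (s'.2 + w.d s'.1 x.2) (arr' x.1)]

theorem Dominates.batchEnd {s s' : Pt × ℝ} (h : Dominates w u s s') :
    Dominates w u (batchEnd w sys s.1, s.2 + w.d s.1 (batchEnd w sys s.1))
      (batchEnd w sys s'.1, s'.2 + w.d s'.1 (OrderPicking.batchEnd w sys s'.1)) := by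
  refine ⟨walkable_batchEnd h.left, walkable_batchEnd h.right, ?_⟩
  have := d_batchEnd_add_le (sys := sys) h.left h.right
  have := h.le
  dsimp only
  linarith

/-- Needed when a batch loses all its items: `restrict` drops it, so only the right walker ends a
batch. -/
theorem Dominates.batchEnd_right {s s' : Pt × ℝ} (h : Dominates w u s s') :
    Dominates w u s
      (OrderPicking.batchEnd w sys s'.1, s'.2 + w.d s'.1 (OrderPicking.batchEnd w sys s'.1)) := by
  have hb := walkable_batchEnd (sys := sys) h.right
  refine ⟨h.left, hb, ?_⟩
  have := w.d_triangle h.left h.right hb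
  have := h.le
  dsimp only
  linarith

/-- The batches that remain when only the items with `f` are collected. -/
def restrict (f : Item n → Bool) (P : List (Tour n)) : List (Tour n) :=
  (P.map (List.filter f)).filter fun B => !B.isEmpty

theorem Dominates.foldl_restrict (harr : ∀ k, arr k ≤ arr' k + u) (f : Item n → Bool)
    {P : List (Tour n)} (hP : ∀ B ∈ P, ∀ x ∈ B, w.Walkable x.2) {s s' : Pt × ℝ}
    (h : Dominates w u s s') :
    Dominates w u ((restrict f P).foldl (serveBatch w sys arr) s)
      (P.foldl (serveBatch w sys arr') s') := by
  induction P generalizing s s' with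
  | nil => exact h
  | cons B P ih =>
    have hB := h.serve_filter harr f (hP B (by simp))
    have ih' := @ih fun C hC => hP C (by simp [hC])
    by_cases he : B.filter f = []
    · have hr : restrict f (B :: P) = restrict f P := by simp [restrict, he]
      rw [hr, List.foldl_cons]
      rw [he] at hB
      exact ih' hB.batchEnd_right
    · have hr : restrict f (B :: P) = B.filter f :: restrict f P := by
        rw [restrict, List.map_cons, List.filter_cons_of_pos]
        · rfl
        · simpa [List.isEmpty_iff] using he
      rw [hr, List.foldl_cons, List.foldl_cons]
      exact ih' hB.batchEnd

theorem completion_restrict_le (harr : ∀ k, arr k ≤ arr' k + u) (f : Item n → Bool)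
    {P : List (Tour n)} (hP : ∀ B ∈ P, ∀ x ∈ B, w.Walkable x.2) {s s' : Pt × ℝ}
    (h : Dominates w u s s') :
    completion w sys arr s (restrict f P) ≤ completion w sys arr' s' P + u :=
  (h.foldl_restrict harr f hP).time_le

/-! ### Tours of bounded length -/

theorem serve_le_of_sorted {φ : Pt → ℝ} {M : ℝ} (hM : ∀ p, w.OnAisle p → φ p ≤ M)
    (hφ : ∀ p q, w.OnAisle p → w.OnAisle q → φ p ≤ φ q → w.d p q ≤ φ q - φ p) {B : Tour n}
    (hB : ∀ x ∈ B, w.OnAisle x.2) (hsort : B.Pairwise fun x y => φ x.2 ≤ φ y.2) {p : Pt}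
    (hp : w.OnAisle p) (hpB : ∀ x ∈ B, φ p ≤ φ x.2) {t : ℝ} (ht : 0 ≤ t) :
    (serve w (fun _ => 0) B (p, t)).2 ≤ t + (M - φ p) := by
  induction B generalizing p t with
  | nil => simpa [serve] using hM p hp
  | cons x B ih =>
    have hx := hB x (by simp)
    have hd := w.d_nonneg p x.2
    have h1 := hφ p x.2 hp hx (hpB x (by simp))
    simp only [serve]
    rw [max_eq_left (by positivity)]
    have := ih (fun y hy => hB y (by simp [hy])) hsort.of_cons hx
      (fun _ => List.rel_of_pairwise_cons hsort) (t := t + w.d p x.2) (by positivity)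
    linarith

variable (w) in
/-- The whole warehouse can be traversed in bounded time. -/
theorem exists_tour_bound : ∃ C : ℝ, 0 ≤ C ∧ ∀ (n : ℕ) (B : Tour n), (∀ x ∈ B, w.OnAisle x.2) →
    ∃ B', B'.Perm B ∧ ∀ p, w.Walkable p → (serve w (fun _ => 0) B' (p, 0)).2 ≤ C := by
  obtain ⟨φ, M, hM0, hM, hφ⟩ := w.exists_potential
  have hD0 : 0 ≤ 2 * (w.len + w.wid) := by
    have := w.len_nonneg; have := w.wid_nonneg; positivity
  -- One diameter to reach the first item, then at most `M` along the items sorted by potential.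
  refine ⟨2 * (w.len + w.wid) + M, by positivity, fun n B hB => ?_⟩
  let r : Item n → Item n → Prop := fun x y => φ x.2 ≤ φ y.2
  have hdec : DecidableRel r := Classical.decRel r
  have : Std.Total r := ⟨fun x y => le_total _ _⟩
  have : IsTrans (Item n) r := ⟨fun x y z => le_trans⟩
  refine ⟨B.insertionSort r, List.perm_insertionSort r B, fun p hp => ?_⟩
  have hsort : (B.insertionSort r).Pairwise r := List.pairwise_insertionSort r B
  have hB' : ∀ x ∈ B.insertionSort r, w.OnAisle x.2 := fun x hx =>
    hB x ((List.perm_insertionSort r B).mem_iff.1 hx)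
  generalize B.insertionSort r = B' at hsort hB'
  cases B' with
  | nil => simpa [serve] using by positivity
  | cons x B' =>
    have hx := hB' x (by simp)
    have hd := w.d_le_diam hp (Or.inl hx)
    have hd0 := w.d_nonneg p x.2
    have := serve_le_of_sorted (fun p hp => (hM p hp).2) hφ (fun y hy => hB' y (by simp [hy]))
      hsort.of_cons hx (fun _ => List.rel_of_pairwise_cons hsort) (t := w.d p x.2) (by positivity)
    simp only [serve, zero_add, max_eq_left hd0]
    linarith [(hM x.2 hx).1]

end Serving

/-! ### Plans -/

section Plans

variable {n : ℕ} {c : ℕ} {Q : Set (Item n)} {P : List (Tour n)}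

theorem mem_ordersOf {B : Tour n} {k : Fin n} : k ∈ ordersOf B ↔ ∃ x ∈ B, x.1 = k := by
  simp [ordersOf]

theorem ordersOf_mono {B B' : Tour n} (h : ∀ x ∈ B, x ∈ B') : ordersOf B ⊆ ordersOf B' := by
  intro k hk
  obtain ⟨x, hx, rfl⟩ := mem_ordersOf.1 hk
  exact mem_ordersOf.2 ⟨x, h x hx, rfl⟩

theorem ordersOf_append (B B' : Tour n) : ordersOf (B ++ B') = ordersOf B ∪ ordersOf B' := by
  simp [ordersOf]

variable (c Q P) in
/-- A solution for the items `Q` in which batches may be empty. -/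
structure IsPreplan : Prop where
  nodup : P.flatten.Nodup
  cover : ∀ x, x ∈ P.flatten ↔ x ∈ Q
  capacity : ∀ B ∈ P, (ordersOf B).card ≤ c
  unsplit : P.Pairwise fun B B' => Disjoint (ordersOf B) (ordersOf B')

theorem IsPlan.isPreplan (h : IsPlan c Q P) : IsPreplan c Q P :=
  ⟨h.nodup, h.cover, h.capacity, h.unsplit⟩

theorem flatten_restrict (f : Item n → Bool) (P : List (Tour n)) :
    (restrict f P).flatten = P.flatten.filter f := by
  rw [restrict, List.flatten_filter_not_isEmpty, List.filter_flatten]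

/-- With `f` constantly true only empty batches disappear, which turns a preplan into a plan. -/
theorem IsPreplan.restrict (h : IsPreplan c Q P) (f : Item n → Bool) :
    IsPlan c {x | x ∈ Q ∧ f x} (restrict f P) where
  nodup := by
    rw [flatten_restrict]
    exact h.nodup.filter f
  cover x := by
    rw [flatten_restrict, List.mem_filter, h.cover]
    rfl
  nonempty B hB := by
    simpa using (List.mem_filter.1 hB).2
  capacity B hB := by
    obtain ⟨C, hC, rfl⟩ := List.mem_map.1 (List.mem_filter.1 hB).1
    exact (Finset.card_le_card (ordersOf_mono fun x hx => (List.mem_filter.1 hx).1)).trans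
      (h.capacity C hC)
  unsplit := by
    refine List.Pairwise.filter _ (List.pairwise_map.2 (h.unsplit.imp fun hd => ?_))
    exact hd.mono (ordersOf_mono fun x hx => (List.mem_filter.1 hx).1)
      (ordersOf_mono fun x hx => (List.mem_filter.1 hx).1)

/-- One batch for each order; orders without items give empty batches, which are discarded. -/
theorem exists_isPlan (hc : 1 ≤ c) (hQ : Q.Finite) : ∃ P, IsPlan c Q P := by
  classical
  let T : Fin n → Tour n := fun k => (hQ.toFinset.filter fun x => x.1 = k).toList
  have hT : ∀ k x, x ∈ T k ↔ x ∈ Q ∧ x.1 = k := by simp [T]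
  have h : IsPreplan c Q ((List.finRange n).map T) := by
    refine ⟨?_, fun x => ?_, fun B hB => ?_, ?_⟩
    · refine List.nodup_flatten.2 ⟨?_, ?_⟩
      · intro l hl
        obtain ⟨k, -, rfl⟩ := List.mem_map.1 hl
        exact Finset.nodup_toList _
      · refine List.pairwise_map.2 ((List.nodup_finRange n).imp fun {k l} hkl => ?_)
        intro x hx hx'
        exact hkl (((hT k x).1 hx).2.symm.trans ((hT l x).1 hx').2)
    · simp only [List.mem_flatten, List.mem_map]
      constructor
      · rintro ⟨_, ⟨k, -, rfl⟩, hx⟩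
        exact ((hT k x).1 hx).1
      · exact fun hx => ⟨_, ⟨x.1, List.mem_finRange _, rfl⟩, (hT _ _).2 ⟨hx, rfl⟩⟩
    · obtain ⟨k, -, rfl⟩ := List.mem_map.1 hB
      refine le_trans (Finset.card_le_card (t := {k}) fun l hl => ?_) (by simpa using hc)
      obtain ⟨x, hx, rfl⟩ := mem_ordersOf.1 hl
      simpa using ((hT k x).1 hx).2
    · refine List.pairwise_map.2 ((List.nodup_finRange n).imp fun {k l} hkl => ?_)
      refine Finset.disjoint_left.2 fun m hm hm' => ?_
      obtain ⟨x, hx, rfl⟩ := mem_ordersOf.1 hm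
      obtain ⟨y, hy, hxy⟩ := mem_ordersOf.1 hm'
      exact hkl (((hT k x).1 hx).2.symm.trans (hxy.symm.trans ((hT l y).1 hy).2))
  refine ⟨_, by simpa using h.restrict fun _ => true⟩

theorem finite_lists {α : Type*} {S : Set α} (hS : S.Finite) (N : ℕ) :
    {l : List α | (∀ x ∈ l, x ∈ S) ∧ l.length ≤ N}.Finite := by
  have := hS.to_subtype
  refine ((List.finite_length_le S N).image (List.map Subtype.val)).subset ?_
  rintro l ⟨hl, hN⟩
  lift l to List S using hl
  exact ⟨l, by simpa using hN, rfl⟩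

theorem length_le_length_flatten {α : Type*} {P : List (List α)} (h : ∀ B ∈ P, B ≠ []) :
    P.length ≤ P.flatten.length := by
  induction P with
  | nil => simp
  | cons B P ih =>
    have h1 := ih fun C hC => h C (by simp [hC])
    have h2 := List.length_pos_iff.2 (h B (by simp))
    simp only [List.length_cons, List.flatten_cons, List.length_append]
    omega

/-- There are finitely many ways to arrange finitely many items in batches. -/
theorem finite_arrangements (hQ : Q.Finite) :
    {P : List (Tour n) | P.flatten.Nodup ∧ (∀ x ∈ P.flatten, x ∈ Q) ∧ ∀ B ∈ P, B ≠ []}.Finite := by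
  refine (finite_lists (finite_lists hQ hQ.toFinset.card) hQ.toFinset.card).subset ?_
  rintro P ⟨hnd, hcov, hne⟩
  have hlen : P.flatten.length ≤ hQ.toFinset.card := by
    classical
    rw [← List.toFinset_card_of_nodup hnd]
    exact Finset.card_le_card fun x hx => by simpa using hcov x (by simpa using hx)
  refine ⟨fun B hB => ⟨fun x hx => hcov x (List.mem_flatten_of_mem hB hx), ?_⟩,
    (length_le_length_flatten hne).trans hlen⟩
  exact (List.sublist_flatten_of_mem hB).length_le.trans hlen

theorem exists_isOptimalPlan (w : Warehouse) (sys : PickingSystem) (hc : 1 ≤ c) (hQ : Q.Finite) :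
    ∃ P, IsOptimalPlan w sys c Q P := by
  have hfin : {P | IsPlan c Q P}.Finite := (finite_arrangements hQ).subset fun P hP =>
    ⟨hP.nodup, fun x => (hP.cover x).1, hP.nonempty⟩
  obtain ⟨P, hP, hmin⟩ := hfin.exists_minimalFor (completion w sys (fun _ => 0) (w.depot, 0)) _
    (exists_isPlan hc hQ)
  exact ⟨P, hP, fun _ hR => (le_total _ _).elim id fun h => hmin hR h⟩

/-- Completing the orders in the cart first, and then following a plan for the others. -/
theorem isReplan_of_isPlan {cart : Finset (Fin n)} {cur : Tour n} (hcart : cart.card ≤ c)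
    (hnd : cur.Nodup) (hcur : ∀ x, x ∈ cur ↔ x ∈ Q ∧ x.1 ∈ cart)
    (hP : IsPlan c {x | x ∈ Q ∧ x.1 ∉ cart} P) : IsReplan c cart Q cur P where
  nodup := List.nodup_append'.2 ⟨hnd, hP.nodup, fun x hx hx' =>
    ((hP.cover x).1 hx').2 ((hcur x).1 hx).2⟩
  cover x := by
    rw [List.mem_append, hcur, hP.cover, Set.mem_ofPred_eq]
    tauto
  commit x hx hxc := (hcur x).2 ⟨hx, hxc⟩
  nonempty := hP.nonempty
  capacity_cur := by
    rwa [Finset.union_eq_left.2]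
    intro k hk
    obtain ⟨x, hx, rfl⟩ := mem_ordersOf.1 hk
    exact ((hcur x).1 hx).2
  capacity_fut := hP.capacity
  unsplit := by
    refine List.pairwise_cons.2 ⟨fun B hB => Finset.disjoint_left.2 fun k hk hk' => ?_, hP.unsplit⟩
    obtain ⟨x, hx, rfl⟩ := mem_ordersOf.1 hk
    obtain ⟨y, hy, hxy⟩ := mem_ordersOf.1 hk'
    exact ((hP.cover y).1 (List.mem_flatten_of_mem hB hy)).2 (hxy ▸ ((hcur x).1 hx).2)

theorem exists_isOptimalReplan (w : Warehouse) (sys : PickingSystem) (hc : 1 ≤ c) (p : Pt)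
    {cart : Finset (Fin n)} (hcart : cart.card ≤ c) (hQ : Q.Finite) :
    ∃ cur fut, IsOptimalReplan w sys c p cart Q cur fut := by
  classical
  have hex : ∃ R : Tour n × List (Tour n), IsReplan c cart Q R.1 R.2 := by
    obtain ⟨P, hP⟩ := exists_isPlan (Q := {x | x ∈ Q ∧ x.1 ∉ cart}) hc (hQ.subset fun x hx => hx.1)
    exact ⟨((hQ.toFinset.filter fun x => x.1 ∈ cart).toList, P),
      isReplan_of_isPlan hcart (Finset.nodup_toList _) (by simp) hP⟩
  have hfin : {R : Tour n × List (Tour n) | IsReplan c cart Q R.1 R.2}.Finite := by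
    refine ((finite_lists hQ hQ.toFinset.card).prod (finite_arrangements hQ)).subset fun R hR => ?_
    have h1 := List.nodup_append'.1 hR.nodup
    refine ⟨⟨fun x hx => (hR.cover x).1 (by simp [hx]), ?_⟩, h1.2.1,
      fun x hx => (hR.cover x).1 (List.mem_append_right _ hx), hR.nonempty⟩
    rw [← List.toFinset_card_of_nodup h1.1]
    exact Finset.card_le_card fun x hx => by
      simpa using (hR.cover x).1 (List.mem_append_left _ (by simpa using hx))
  obtain ⟨R, hR, hmin⟩ := hfin.exists_minimalFor
    (fun R => completion w sys (fun _ => 0) (p, 0) (R.1 :: R.2)) _ hex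
  exact ⟨R.1, R.2, hR, fun cur fut h => (le_total _ _).elim id
    fun h' => hmin (j := (cur, fut)) h h'⟩

theorem finite_itemsOf (I : Instance n) (A : Finset (Fin n)) : (I.itemsOf A).Finite := by
  classical
  refine (Finset.finite_toSet (A.biUnion fun k => (I.locs k).image fun p => (k, p))).subset ?_
  rintro ⟨k, p⟩ ⟨hk, hp⟩
  simpa using ⟨hp, hk⟩

theorem ciopt_le (w : Warehouse) (sys : PickingSystem) (I : Instance n)
    (hI : ∀ k, ∀ p ∈ I.locs k, w.OnAisle p) (hP : IsPreplan c (I.itemsOf Finset.univ) P) :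
    CIOPT w sys c I ≤ completion w sys I.arr (w.depot, 0) P := by
  have hw : ∀ B ∈ P, ∀ x ∈ B, w.Walkable x.2 := fun B hB x hx =>
    Or.inl (hI _ _ ((hP.cover x).1 (List.mem_flatten_of_mem hB hx)).2)
  have h := completion_restrict_le (sys := sys) (u := 0) (arr := I.arr) (arr' := I.arr) (by simp)
    (fun _ => true) hw (Dominates.refl (s := (w.depot, 0)) w.walkable_depot)
  rw [add_zero] at h
  refine (csInf_le ⟨0, ?_⟩ ?_).trans h
  · rintro _ ⟨P, -, rfl⟩
    exact completion_nonneg P _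
  · exact ⟨_, by simpa using hP.restrict fun _ => true, rfl⟩

/-- The existence of a plan, which needs `1 ≤ c`, is essential: over an empty set the infimum would
be 0 by default. -/
theorem le_ciopt (w : Warehouse) (sys : PickingSystem) (hc : 1 ≤ c) (I : Instance n) {T : ℝ}
    (h : ∀ P, IsPlan c (I.itemsOf Finset.univ) P →
      T ≤ completion w sys I.arr (w.depot, 0) P) : T ≤ CIOPT w sys c I := by
  obtain ⟨P, hP⟩ := exists_isPlan hc (finite_itemsOf I Finset.univ)
  refine le_csInf ⟨_, P, hP, rfl⟩ ?_
  rintro _ ⟨P, hP, rfl⟩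
  exact h P hP

end Plans

section Policies

variable {w : Warehouse} {sys : PickingSystem} {n c : ℕ} {I : Instance n}

theorem Instance.mem_arrived {t : ℝ} {k : Fin n} : k ∈ I.arrived t ↔ I.arr k ≤ t := by
  simp [Instance.arrived]

theorem Instance.exists_isNext {A : Finset (Fin n)} (hA : A ≠ Finset.univ) :
    ∃ k, I.IsNext A k := by
  have hne : Aᶜ.Nonempty := by
    rwa [Finset.nonempty_iff_ne_empty, Ne, Finset.compl_eq_empty_iff]
  obtain ⟨k, hk, hmin⟩ := Finset.exists_min_image _ I.arr hne
  exact ⟨k, Finset.mem_compl.1 hk, fun m hm => hmin m (Finset.mem_compl.2 hm)⟩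

theorem exists_notMem_of_ne_univ {A : Finset (Fin n)} (hA : A ≠ Finset.univ) : ∃ k, k ∉ A := by
  by_contra! h
  exact hA (Finset.eq_univ_iff_forall.2 h)

/-- The part of a plan that has not been executed can be planned anew, together with the items of
new orders. -/
theorem IsPreplan.replan {K A : Finset (Fin n)} {done R P : List (Tour n)}
    (h : IsPreplan c (I.itemsOf K) (done ++ R)) (hKA : K ⊆ A)
    (hP : IsPreplan c ({x | x ∈ R.flatten} ∪ I.itemsOf (A \ K)) P) :
    IsPreplan c (I.itemsOf A) (done ++ P) := by
  have hnd := h.nodup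
  rw [List.flatten_append, List.nodup_append'] at hnd
  have hK : ∀ x, x ∈ done.flatten ∨ x ∈ R.flatten ↔ x ∈ I.itemsOf K := fun x => by
    rw [← h.cover, List.flatten_append, List.mem_append]
  have hnew : ∀ x, x ∈ I.itemsOf (A \ K) ↔ x ∈ I.itemsOf A ∧ x.1 ∉ K := fun x => by
    simp only [Instance.itemsOf, Set.mem_ofPred_eq, Finset.mem_sdiff]
    tauto
  refine ⟨?_, fun x => ?_, fun B hB => ?_, ?_⟩
  · rw [List.flatten_append, List.nodup_append']
    refine ⟨hnd.1, hP.nodup, fun x hx hx' => ?_⟩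
    rcases (hP.cover x).1 hx' with h' | h'
    · exact hnd.2.2 hx h'
    · exact ((hnew x).1 h').2 ((hK x).1 (Or.inl hx)).1
  · rw [List.flatten_append, List.mem_append, hP.cover, Set.mem_union, hnew]
    have hx := hK x
    have hmono : x ∈ I.itemsOf K → x ∈ I.itemsOf A := fun hx => ⟨hKA hx.1, hx.2⟩
    have hback : x ∈ I.itemsOf A → x.1 ∈ K → x ∈ I.itemsOf K := fun h h' => ⟨h', h.2⟩
    change _ ∨ x ∈ R.flatten ∨ _ ↔ _
    tauto
  · rcases List.mem_append.1 hB with hB | hB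
    · exact h.capacity B (List.mem_append_left _ hB)
    · exact hP.capacity B hB
  · have hu := List.pairwise_append.1 h.unsplit
    refine List.pairwise_append.2 ⟨hu.1, hP.unsplit, fun B hB B' hB' => ?_⟩
    refine Finset.disjoint_left.2 fun k hk hk' => ?_
    obtain ⟨x, hx, rfl⟩ := mem_ordersOf.1 hk
    obtain ⟨y, hy, hxy⟩ := mem_ordersOf.1 hk'
    rcases (hP.cover y).1 (List.mem_flatten_of_mem hB' hy) with h' | h'
    · obtain ⟨C, hC, hyC⟩ := List.mem_flatten.1 h'
      exact Finset.disjoint_left.1 (hu.2.2 B hB C hC) hk (mem_ordersOf.2 ⟨y, hyC, hxy⟩)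
    · refine ((hnew y).1 h').2 ?_
      rw [hxy]
      exact ((hK x).1 (Or.inl (List.mem_flatten_of_mem hB hx))).1

/-- Restricting a plan for all orders to a part of the items, and dropping the waiting times, delays
it by no more than the start of the walk does. -/
theorem exists_isPlan_completion_le (hI : ∀ k, ∀ p ∈ I.locs k, w.OnAisle p) {Q : Set (Item n)}
    (hQ : Q ⊆ I.itemsOf Finset.univ) {P : List (Tour n)}
    (hP : IsPlan c (I.itemsOf Finset.univ) P) {s : Pt × ℝ} {u : ℝ} (hu : ∀ k, 0 ≤ I.arr k + u)
    (hs : Dominates w u s (w.depot, 0)) :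
    ∃ P', IsPlan c Q P' ∧ completion w sys (fun _ => 0) s P' ≤
      completion w sys I.arr (w.depot, 0) P + u := by
  classical
  have hw : ∀ B ∈ P, ∀ x ∈ B, w.Walkable x.2 := fun B hB x hx =>
    Or.inl (hI _ _ ((hP.cover x).1 (List.mem_flatten_of_mem hB hx)).2)
  refine ⟨restrict (fun x => decide (x ∈ Q)) P, ?_, completion_restrict_le hu _ hw hs⟩
  convert hP.isPreplan.restrict fun x => decide (x ∈ Q) using 1
  ext x
  simpa using fun h => hQ h

/-! ### Noninterventionist reoptimization -/

theorem foldl_serveBatch_fst_pcartN {arr : Fin n → ℝ} (P : List (Tour n)) (t : ℝ) :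
    (P.foldl (serveBatch w .pcartN arr) (w.depot, t)).1 = w.depot := by
  induction P using List.reverseRecOn with
  | nil => rfl
  | append_singleton P B _ => rw [List.foldl_append]; rfl

theorem foldl_serveBatch_pcartN {arr : Fin n → ℝ} (P : List (Tour n)) (t : ℝ) :
    P.foldl (serveBatch w .pcartN arr) (w.depot, t) =
      (w.depot, completion w .pcartN arr (w.depot, t) P) :=
  Prod.ext (foldl_serveBatch_fst_pcartN P t) rfl

/-- Every pushcart batch ends at the depot, so a sequence of batches acts on the time alone and can
be cut between batches. -/
theorem completion_append_pcartN {arr : Fin n → ℝ} (P P' : List (Tour n)) (t : ℝ) :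
    completion w .pcartN arr (w.depot, t) (P ++ P') =
      completion w .pcartN arr (w.depot, completion w .pcartN arr (w.depot, t) P) P' := by
  rw [completion, List.foldl_append, foldl_serveBatch_pcartN, ← completion]

theorem completion_mono_pcartN {arr : Fin n → ℝ} {P : List (Tour n)}
    (hP : ∀ B ∈ P, ∀ x ∈ B, w.Walkable x.2) (hne : ∀ B ∈ P, B ≠ []) {t t' : ℝ} (h : t ≤ t') :
    completion w .pcartN arr (w.depot, t) P ≤ completion w .pcartN arr (w.depot, t') P := by
  have hr : restrict (fun _ => true) P = P := by
    have hmap : P.map (List.filter fun _ => true) = P :=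
      (List.map_congr_left fun B _ => List.filter_eq_self.2 fun _ _ => rfl).trans (List.map_id P)
    rw [restrict, hmap, List.filter_eq_self]
    simpa using hne
  have := completion_restrict_le (sys := .pcartN) (u := 0) (arr := arr) (arr' := arr) (by simp)
    (fun _ => true) hP (s := (w.depot, t)) (s' := (w.depot, t'))
    ⟨w.walkable_depot, w.walkable_depot, by simpa using h⟩
  simpa [hr] using this

variable (w c I) in
/-- The batches that have been collected and those that are planned form a plan for the orders
that are known. -/
structure NInvariant (s : NState n) : Prop where
  time_nonneg : 0 ≤ s.time
  known_arrived : ∀ k ∈ s.known, I.arr k ≤ s.time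
  nonempty : ∀ B ∈ s.plan, B ≠ []
  exists_done : ∃ done, completion w .pcartN I.arr (w.depot, 0) done ≤ s.time ∧
    IsPreplan c (I.itemsOf s.known) (done ++ s.plan)

theorem NInvariant.initial : NInvariant w c I ⟨0, [], ∅⟩ := by
  refine ⟨le_rfl, by simp, by simp, [], le_rfl, by simp, ?_, by simp, by simp⟩
  simp [Instance.itemsOf]

theorem NInvariant.plan_subset {s : NState n} (h : NInvariant w c I s) {x : Item n}
    (hx : x ∈ s.plan.flatten) : x ∈ I.itemsOf s.known := by
  obtain ⟨done, -, hd⟩ := h.exists_done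
  exact (hd.cover x).1 (by simp only [List.flatten_append, List.mem_append]; exact Or.inr hx)

theorem itemsOf_subset_univ (A : Finset (Fin n)) : I.itemsOf A ⊆ I.itemsOf Finset.univ :=
  fun _ hx => ⟨Finset.mem_univ _, hx.2⟩

theorem NInvariant.todo_subset {s : NState n} (h : NInvariant w c I s) (A : Finset (Fin n)) :
    {x | x ∈ s.plan.flatten} ∪ I.itemsOf A ⊆ I.itemsOf Finset.univ :=
  Set.union_subset (fun _ hx => itemsOf_subset_univ _ (h.plan_subset hx)) (itemsOf_subset_univ A)

/-- A batch contains only known orders, which have arrived when it starts. Hence it involves no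
waiting, and its duration under the true arrival times is the planned one. -/
theorem NInvariant.step (hI : ∀ k, ∀ p ∈ I.locs k, w.OnAisle p) {s s' : NState n}
    (h : NInvariant w c I s) (hs : NStep w c I s s') : NInvariant w c I s' := by
  obtain ⟨done, ht, hd⟩ := h.exists_done
  cases hs with
  | reopt P hnew hP =>
    refine ⟨h.time_nonneg, fun k hk => Instance.mem_arrived.1 hk, hP.1.nonempty, done, ht,
      hd.replan (fun k hk => Instance.mem_arrived.2 (h.known_arrived k hk)) hP.1.isPreplan⟩
  | batch B P hplan hold =>
    have hB : ∀ x ∈ B, x ∈ I.itemsOf s.known := fun x hx =>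
      h.plan_subset (by simp [hplan, hx])
    have hle : s.time ≤ completion w .pcartN (fun _ => 0) (w.depot, s.time) [B] :=
      le_foldl_serveBatch [B] (w.depot, s.time)
    refine ⟨h.time_nonneg.trans hle, fun k hk => (h.known_arrived k hk).trans hle,
      fun C hC => h.nonempty C (by simp [hplan, hC]), done ++ [B], ?_, ?_⟩
    · rw [completion_append_pcartN]
      refine (completion_mono_pcartN ?_ ?_ ht).trans (le_of_eq ?_)
      · intro B' hB' x hx
        rw [List.mem_singleton.1 hB'] at hx
        exact Or.inl (hI _ _ (hB x hx).2)
      · simpa using h.nonempty B (by simp [hplan])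
      · simp only [completion, List.foldl_cons, List.foldl_nil, serveBatch]
        rw [serve_eq_of_arrived h.time_nonneg fun x hx => h.known_arrived _ (hB x hx).1]
    · simpa [hplan] using hd
  | idle k hplan hk hlt =>
    exact ⟨h.time_nonneg.trans hlt.le, fun m hm => (h.known_arrived m hm).trans hlt.le, by simp,
      done, ht.trans hlt.le, by simpa [hplan] using hd⟩

theorem NInvariant.of_reachable (hI : ∀ k, ∀ p ∈ I.locs k, w.OnAisle p) {s : NState n}
    (hs : Relation.ReflTransGen (NStep w c I) ⟨0, [], ∅⟩ s) : NInvariant w c I s := by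
  induction hs with
  | refl => exact NInvariant.initial
  | tail _ hstep ih => exact ih.step hI hstep

theorem ciopt_le_of_isNReopt (hI : ∀ k, ∀ p ∈ I.locs k, w.OnAisle p) {T : ℝ}
    (hT : IsNReopt w c I T) : CIOPT w .pcartN c I ≤ T := by
  obtain ⟨done, ht, hd⟩ := (NInvariant.of_reachable hI hT).exists_done
  rw [List.append_nil] at hd
  exact (ciopt_le w .pcartN I hI hd).trans ht

theorem NInvariant.exists_reopt (hc : 1 ≤ c) {s : NState n} (h : NInvariant w c I s)
    (hnew : ∃ k, k ∉ s.known ∧ I.arr k ≤ s.time) :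
    ∃ P, NStep w c I s ⟨s.time, P, I.arrived s.time⟩ := by
  obtain ⟨P, hP⟩ := exists_isOptimalPlan w .pcartN hc
    ((finite_itemsOf I Finset.univ).subset (h.todo_subset (I.arrived s.time \ s.known)))
  exact ⟨P, NStep.reopt s P hnew hP⟩

theorem card_compl_arrived_lt {K : Finset (Fin n)} {t : ℝ} (hK : ∀ k ∈ K, I.arr k ≤ t)
    (hnew : ∃ k, k ∉ K ∧ I.arr k ≤ t) : (I.arrived t)ᶜ.card < Kᶜ.card := by
  obtain ⟨k, hk, hkt⟩ := hnew
  refine Finset.card_lt_card (Finset.ssubset_iff_of_subset ?_ |>.2 ⟨k, by simpa using hk, ?_⟩)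
  · exact Finset.compl_subset_compl.2 fun m hm => Instance.mem_arrived.2 (hK m hm)
  · simpa [Instance.mem_arrived] using hkt

/-- Induction on the number of unknown orders, then on the number of planned batches. An idle step
lowers neither, but a replanning follows at once. -/
theorem NInvariant.exists_completion (hI : ∀ k, ∀ p ∈ I.locs k, w.OnAisle p) (hc : 1 ≤ c)
    {s : NState n} (h : NInvariant w c I s) :
    ∃ T, Relation.ReflTransGen (NStep w c I) s ⟨T, [], Finset.univ⟩ := by
  obtain ⟨m, hm⟩ : ∃ m, s.knownᶜ.card = m := ⟨_, rfl⟩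
  induction m using Nat.strong_induction_on generalizing s with
  | _ m ih =>
  have reopt : ∀ s : NState n, NInvariant w c I s → s.knownᶜ.card = m →
      (∃ k, k ∉ s.known ∧ I.arr k ≤ s.time) →
      ∃ T, Relation.ReflTransGen (NStep w c I) s ⟨T, [], Finset.univ⟩ := by
    intro s h hm hnew
    obtain ⟨P, hP⟩ := h.exists_reopt hc hnew
    obtain ⟨T, hT⟩ := ih _ (hm ▸ card_compl_arrived_lt h.known_arrived hnew) (h.step hI hP) rfl
    exact ⟨T, .head hP hT⟩
  obtain ⟨l, hl⟩ : ∃ l, s.plan.length = l := ⟨_, rfl⟩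
  induction l generalizing s with
  | zero =>
    have hplan : s.plan = [] := List.length_eq_zero_iff.1 hl
    by_cases hnew : ∃ k, k ∉ s.known ∧ I.arr k ≤ s.time
    · exact reopt s h hm hnew
    · by_cases hu : s.known = Finset.univ
      · obtain ⟨t, P, K⟩ := s
        obtain rfl := hplan
        obtain rfl := hu
        exact ⟨t, .refl⟩
      · obtain ⟨k, hk⟩ := I.exists_isNext hu
        push Not at hnew
        have hstep := NStep.idle (w := w) (c := c) s k hplan hk (hnew k hk.1)
        obtain ⟨T, hT⟩ := reopt _ (h.step hI hstep) hm ⟨k, hk.1, le_rfl⟩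
        exact ⟨T, .head hstep hT⟩
  | succ l ihl =>
    by_cases hnew : ∃ k, k ∉ s.known ∧ I.arr k ≤ s.time
    · exact reopt s h hm hnew
    · push Not at hnew
      obtain ⟨B, P, hplan⟩ := List.exists_cons_of_length_eq_add_one hl
      have hstep := NStep.batch (w := w) (c := c) s B P hplan fun k hk => (hnew k hk).le
      obtain ⟨T, hT⟩ := ihl (h.step hI hstep) hm (by simpa [hplan] using hl)
      exact ⟨T, .head hstep hT⟩

theorem exists_isNReopt (hI : ∀ k, ∀ p ∈ I.locs k, w.OnAisle p) (hc : 1 ≤ c) :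
    ∃ T, IsNReopt w c I T :=
  NInvariant.initial.exists_completion hI hc

theorem IsPlan.replace {Q : Set (Item n)} {P₁ P₂ : List (Tour n)} {B B' : Tour n}
    (h : IsPlan c Q (P₁ ++ B :: P₂)) (hB : B'.Perm B) : IsPlan c Q (P₁ ++ B' :: P₂) := by
  have hperm : (P₁ ++ B' :: P₂).flatten.Perm (P₁ ++ B :: P₂).flatten := by
    simp only [List.flatten_append, List.flatten_cons]
    exact (hB.append_right _).append_left _
  have hord : ordersOf B' = ordersOf B :=
    (ordersOf_mono fun x => hB.mem_iff.1).antisymm (ordersOf_mono fun x => hB.mem_iff.2)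
  refine ⟨hperm.nodup_iff.2 h.nodup, fun x => hperm.mem_iff.trans (h.cover x), ?_, ?_, ?_⟩
  · have := h.nonempty
    simp only [List.mem_append, List.mem_cons] at this ⊢
    rintro C (hC | rfl | hC)
    · exact this C (Or.inl hC)
    · rintro rfl
      exact this B (Or.inr (Or.inl rfl)) hB.nil_eq.symm
    · exact this C (Or.inr (Or.inr hC))
  · have := h.capacity
    simp only [List.mem_append, List.mem_cons] at this ⊢
    rintro C (hC | rfl | hC)
    · exact this C (Or.inl hC)
    · rw [hord]
      exact this B (Or.inr (Or.inl rfl))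
    · exact this C (Or.inr (Or.inr hC))
  · have := h.unsplit
    simp only [List.pairwise_append, List.pairwise_cons, List.mem_cons, forall_eq_or_imp] at this ⊢
    simpa only [hord] using this

/-- No batch of an optimal plan can be shortened by another visiting sequence. -/
theorem IsOptimalPlan.batch_le {Q : Set (Item n)} {P : List (Tour n)}
    (h : IsOptimalPlan w .pcartN c Q P) {B B' : Tour n} (hB : B ∈ P) (hB' : B'.Perm B) :
    completion w .pcartN (fun _ => 0) (w.depot, 0) [B] ≤
      completion w .pcartN (fun _ => 0) (w.depot, 0) [B'] := by
  obtain ⟨P₁, P₂, rfl⟩ := List.append_of_mem hB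
  have h1 := h.2 _ (h.1.replace hB')
  have key : ∀ C : Tour n, completion w .pcartN (fun _ => 0) (w.depot, 0) (P₁ ++ C :: P₂) =
      completion w .pcartN (fun _ => 0) (w.depot, 0) P₂ +
        (completion w .pcartN (fun _ => 0) (w.depot, 0) [C] +
          completion w .pcartN (fun _ => 0) (w.depot, 0) P₁) := fun C => by
    have h0 := completion_nonneg (w := w) (sys := .pcartN) (arr := fun _ => 0) P₁ w.depot
    have h0' := completion_nonneg (w := w) (sys := .pcartN) (arr := fun _ => 0) [C] w.depot
    rw [completion_append_pcartN, ← List.singleton_append, completion_append_pcartN,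
      completion_zero_eq_add [C] _ h0, completion_zero_eq_add P₂ _ (by positivity)]
  rw [key, key] at h1
  linarith

theorem isNReopt_le (hI : ∀ k, ∀ p ∈ I.locs k, w.OnAisle p) (hc : 1 ≤ c)
    (harr : ∀ k, 0 ≤ I.arr k) {R C T : ℝ} (hR0 : 0 ≤ R) (hR : ∀ k, I.arr k ≤ R)
    (hC : ∀ B : Tour n, (∀ x ∈ B, w.OnAisle x.2) →
      ∃ B', B'.Perm B ∧ ∀ p, w.Walkable p → (serve w (fun _ => 0) B' (p, 0)).2 ≤ C)
    (hT : IsNReopt w c I T) :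
    T ≤ CIOPT w .pcartN c I + R + (C + 2 * (w.len + w.wid)) := by
  set D := 2 * (w.len + w.wid) with hD
  have hS0 : 0 ≤ CIOPT w .pcartN c I := le_ciopt w _ hc I fun P _ => completion_nonneg P _
  have hCD : 0 ≤ C + D := by
    obtain ⟨B', -, h⟩ := hC [] (by simp)
    have h1 := h _ w.walkable_depot
    have h2 := le_serve (w := w) (arr := fun _ => 0) B' (w.depot, 0)
    have h3 := (w.d_nonneg _ _).trans (w.d_le_diam w.walkable_depot w.walkable_depot)
    dsimp only at h2
    linarith
  -- Optimality keeps every planned batch as short as a sweep, `C + D`. While an order is unknown,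
  -- batches start no later than its arrival, hence by `R`, and end by `R + (C + D)`. Once all
  -- orders are known, the predicted completion is invariant.
  have key : ∀ s, Relation.ReflTransGen (NStep w c I) ⟨0, [], ∅⟩ s →
      (∀ B ∈ s.plan, completion w .pcartN (fun _ => 0) (w.depot, 0) [B] ≤ C + D) ∧
      (s.known ≠ Finset.univ → s.time ≤ R + (C + D)) ∧
      (s.known = Finset.univ → completion w .pcartN (fun _ => 0) (w.depot, s.time) s.plan ≤
        CIOPT w .pcartN c I + R + (C + D)) := by
    intro s hs
    induction hs with
    | refl => exact ⟨by simp, fun _ => by positivity, fun _ => by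
        change (0 : ℝ) ≤ _
        positivity⟩
    | @tail s s' hs hstep ih =>
      have hinv := NInvariant.of_reachable hI hs
      obtain ⟨ihB, ihne, iheq⟩ := ih
      cases hstep with
      | reopt P hnew hP =>
        obtain ⟨k, hk, hkt⟩ := hnew
        have hne : s.known ≠ Finset.univ := fun h => hk (h ▸ Finset.mem_univ k)
        have hsub := hinv.todo_subset (I.arrived s.time \ s.known)
        refine ⟨fun B hB => ?_, fun _ => ihne hne, fun _ => ?_⟩
        · have hBa : ∀ x ∈ B, w.OnAisle x.2 := fun x hx =>
            hI _ _ (hsub ((hP.1.cover x).1 (List.mem_flatten_of_mem hB hx))).2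
          obtain ⟨B', hperm, hB'⟩ := hC B hBa
          refine (hP.batch_le hB hperm).trans ?_
          refine add_le_add (hB' _ w.walkable_depot) (w.d_le_diam ?_ w.walkable_depot)
          exact walkable_serve (fun x hx => Or.inl (hBa x (hperm.mem_iff.1 hx))) w.walkable_depot
        · have h1 : completion w .pcartN (fun _ => 0) (w.depot, 0) P ≤ CIOPT w .pcartN c I := by
            refine le_ciopt w _ hc I fun P' hP' => ?_
            obtain ⟨P'', h'', hle⟩ := exists_isPlan_completion_le (sys := .pcartN) hI hsub hP'
              (u := 0) (by simpa using harr) (Dominates.refl w.walkable_depot)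
            exact (hP.2 P'' h'').trans (by simpa using hle)
          dsimp only
          rw [completion_zero_eq_add P _ hinv.time_nonneg]
          linarith [ihne hne]
      | batch B P hplan hold =>
        refine ⟨fun B' hB' => ihB B' (by simp [hplan, hB']), fun hne => ?_, fun heq => ?_⟩
        · obtain ⟨k, hk⟩ := exists_notMem_of_ne_univ hne
          dsimp only at hk ⊢
          rw [completion_zero_eq_add _ _ hinv.time_nonneg]
          linarith [hold k hk, hR k, ihB B (by simp [hplan])]
        · have := iheq heq
          rwa [hplan, ← List.singleton_append, completion_append_pcartN] at this
      | idle k hplan hk hlt =>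
        exact ⟨by simp, fun _ => (hR k).trans (by linarith),
          fun heq => absurd (heq ▸ Finset.mem_univ k) hk.1⟩
  exact (key _ hT).2.2 rfl

/-- Batches take no time here, so the clock advances only by idling until an arrival. -/
theorem isNReopt_le_of_depot (hI : ∀ k, ∀ p ∈ I.locs k, p = w.depot)
    (hIa : ∀ k, ∀ p ∈ I.locs k, w.OnAisle p) {R T : ℝ} (hR0 : 0 ≤ R)
    (hR : ∀ k, I.arr k ≤ R) (hT : IsNReopt w c I T) : T ≤ R := by
  have key : ∀ s, Relation.ReflTransGen (NStep w c I) ⟨0, [], ∅⟩ s → s.time ≤ R := by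
    intro s hs
    induction hs with
    | refl => exact hR0
    | @tail s s' hs hstep ih =>
      have hinv := NInvariant.of_reachable hIa hs
      cases hstep with
      | reopt P hnew hP => exact ih
      | batch B P hplan hold =>
        have hB : ∀ x ∈ B, x.2 = w.depot := fun x hx =>
          hI _ _ (hinv.plan_subset (x := x) (by simp [hplan, hx])).2
        simpa [completion, serveBatch, serve_of_forall_eq hB hinv.time_nonneg, batchEnd] using ih
      | idle k hplan hk hlt => exact hR k
  exact key _ hT

/-! ### Interventionist reoptimization -/

variable (w sys c I) in
/-- The batches that have been collected, the current batch and the planned ones form a plan for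
the orders that are known, and no arrival has been ignored. -/
structure IInvariant (s : IState n) : Prop where
  time_nonneg : 0 ≤ s.time
  known_arrived : ∀ k ∈ s.known, I.arr k ≤ s.time
  not_passed : ∀ k, k ∉ s.known → s.time ≤ I.arr k
  exists_done : ∃ done picked, ordersOf picked = s.cart ∧
    Dominates w 0 (serve w I.arr picked (done.foldl (serveBatch w sys I.arr) (w.depot, 0)))
      (s.pos, s.time) ∧
    IsPreplan c (I.itemsOf s.known) (done ++ (picked ++ s.cur) :: s.fut)

theorem IInvariant.initial (harr : ∀ k, 0 ≤ I.arr k) :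
    IInvariant w sys c I ⟨0, w.depot, ∅, [], [], ∅⟩ := by
  refine ⟨le_rfl, by simp, fun k _ => harr k, [], [], rfl, Dominates.refl w.walkable_depot,
    by simp, ?_, ?_, by simp⟩
  · simp [Instance.itemsOf]
  · simp [ordersOf]

theorem IInvariant.walkable_pos {s : IState n} (h : IInvariant w sys c I s) : w.Walkable s.pos := by
  obtain ⟨_, _, -, hd, -⟩ := h.exists_done
  exact hd.right

theorem IInvariant.plan_subset {s : IState n} (h : IInvariant w sys c I s) {x : Item n}
    (hx : x ∈ s.cur ++ s.fut.flatten) : x ∈ I.itemsOf s.known := by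
  obtain ⟨done, picked, -, -, hd⟩ := h.exists_done
  refine (hd.cover x).1 ?_
  simp only [List.flatten_append, List.flatten_cons, List.mem_append] at hx ⊢
  tauto

theorem IInvariant.todo_subset {s : IState n} (h : IInvariant w sys c I s) (A : Finset (Fin n)) :
    {x | x ∈ s.cur ++ s.fut.flatten} ∪ I.itemsOf A ⊆ I.itemsOf Finset.univ :=
  Set.union_subset (fun _ hx => itemsOf_subset_univ _ (h.plan_subset hx)) (itemsOf_subset_univ A)

theorem IInvariant.card_cart_le {s : IState n} (h : IInvariant w sys c I s) : s.cart.card ≤ c := by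
  obtain ⟨done, picked, hcart, -, hd⟩ := h.exists_done
  refine le_trans (Finset.card_le_card ?_) (hd.capacity (picked ++ s.cur) (by simp))
  rw [ordersOf_append, hcart]
  exact Finset.subset_union_left

/-- The picked items of the current cart together with a replanning. -/
theorem IsReplan.isPreplan {K A cart : Finset (Fin n)} {picked cur cur' : Tour n}
    {done fut fut' : List (Tour n)} (hcart : ordersOf picked = cart)
    (h : IsPreplan c (I.itemsOf K) (done ++ (picked ++ cur) :: fut))
    (h' : IsReplan c cart ({x | x ∈ cur ++ fut.flatten} ∪ I.itemsOf (A \ K)) cur' fut') :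
    IsPreplan c ({x | x ∈ ((picked ++ cur) :: fut).flatten} ∪ I.itemsOf (A \ K))
      ((picked ++ cur') :: fut') := by
  have hnd := h.nodup
  rw [List.flatten_append, List.flatten_cons, List.append_assoc] at hnd
  have hnd' := List.nodup_append'.1 (List.nodup_append'.1 hnd).2.1
  have hnd'' := List.nodup_append'.1 h'.nodup
  refine ⟨?_, fun x => ?_, fun B hB => ?_, ?_⟩
  · rw [List.flatten_cons, List.append_assoc, List.nodup_append']
    refine ⟨hnd'.1, h'.nodup, fun x hx hx' => ?_⟩
    rcases (h'.cover x).1 hx' with h₁ | h₁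
    · exact hnd'.2.2 hx h₁
    · have hK : x ∈ I.itemsOf K := (h.cover x).1 (by simp [hx])
      exact (Finset.mem_sdiff.1 h₁.1).2 hK.1
  · have hx := h'.cover x
    rw [List.flatten_cons, List.append_assoc, List.mem_append, hx]
    simp only [Set.mem_union, Set.mem_ofPred_eq, List.flatten_cons, List.mem_append]
    tauto
  · rcases List.mem_cons.1 hB with rfl | hB
    · rw [ordersOf_append, hcart]
      exact h'.capacity_cur
    · exact h'.capacity_fut B hB
  · have hu := List.pairwise_cons.1 h'.unsplit
    refine List.pairwise_cons.2 ⟨fun B hB => ?_, hu.2⟩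
    rw [ordersOf_append, hcart, Finset.disjoint_union_left]
    refine ⟨Finset.disjoint_left.2 fun k hk hk' => ?_, hu.1 B hB⟩
    obtain ⟨y, hy, rfl⟩ := mem_ordersOf.1 hk'
    have hyf := List.mem_flatten_of_mem hB hy
    exact hnd''.2.2 (h'.commit y ((h'.cover y).1 (List.mem_append_right _ hyf)) hk) hyf

theorem IInvariant.step (hI : ∀ k, ∀ p ∈ I.locs k, w.OnAisle p) {s s' : IState n}
    (h : IInvariant w sys c I s) (hs : IStep w sys c I s s') : IInvariant w sys c I s' := by
  obtain ⟨done, picked, hcart, hdom, hd⟩ := h.exists_done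
  have ht0 := h.time_nonneg
  cases hs with
  | reopt cur fut hnew hP =>
    refine ⟨ht0, fun k hk => Instance.mem_arrived.1 hk,
      fun k hk => le_of_not_ge fun hle => hk (Instance.mem_arrived.2 hle),
      done, picked, hcart, hdom, ?_⟩
    exact hd.replan (fun k hk => Instance.mem_arrived.2 (h.known_arrived k hk))
      (hP.1.isPreplan hcart hd)
  -- By `hp₁` the elapsed time is the distance walked, so the triangle inequality preserves the
  -- domination at an intermediate point.
  | walk k p hk ht hle hp hp₁ hp₂ =>
    refine ⟨ht0.trans ht.le, fun m hm => (h.known_arrived m hm).trans ht.le, fun m hm => hk.2 m hm,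
      done, picked, hcart, ⟨hdom.left, hp, ?_⟩, hd⟩
    have h1 := w.d_triangle hdom.left hdom.right hp
    have h2 := hdom.le
    dsimp only at h1 h2 ⊢
    linarith
  | pick x B hcur ht =>
    have hx : x ∈ I.itemsOf s.known := h.plan_subset (by simp [hcur])
    have hxw : w.Walkable x.2 := Or.inl (hI _ _ hx.2)
    have hle : s.time ≤ s.time + w.d s.pos x.2 := le_add_of_nonneg_right (w.d_nonneg _ _)
    refine ⟨ht0.trans hle, fun m hm => (h.known_arrived m hm).trans hle, ht,
      done, picked ++ [x], ?_, ?_, by simpa [hcur] using hd⟩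
    · rw [ordersOf_append, hcart, Finset.union_comm]
      simp [ordersOf]
    · rw [serve_append]
      refine ⟨hxw, hxw, ?_⟩
      have h1 := w.d_triangle hdom.left hdom.right hxw
      have h2 := hdom.le
      have h3 := h.known_arrived _ hx.1
      simp only [serve, Warehouse.d_self, add_zero]
      dsimp only at h1 h2
      exact max_le (by linarith) (by linarith)
  | close hcur hni ht =>
    have hle : s.time ≤ s.time + w.d s.pos (batchEnd w sys s.pos) :=
      le_add_of_nonneg_right (w.d_nonneg _ _)
    refine ⟨ht0.trans hle, fun m hm => (h.known_arrived m hm).trans hle, ht,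
      done ++ [picked], [], rfl, ?_, ?_⟩
    · rw [List.foldl_append]
      exact hdom.batchEnd
    · rw [hcur, List.append_nil] at hd
      cases hfut : s.fut with
      | nil =>
        rw [hfut] at hd
        refine ⟨?_, ?_, ?_, ?_⟩
        · simpa using hd.nodup
        · simpa using hd.cover
        · simpa [or_imp, forall_and, ordersOf] using hd.capacity
        · rw [List.nil_append, List.headD_nil, List.tail_nil, List.pairwise_append]
          exact ⟨hd.unsplit, by simp, by simp [ordersOf]⟩
      | cons B P => simpa [hfut] using hd
  | idle k hidle hk ht =>
    refine ⟨ht0.trans ht.le, fun m hm => (h.known_arrived m hm).trans ht.le, fun m hm => hk.2 m hm,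
      done, picked, hcart, ⟨hdom.left, hdom.right, ?_⟩, hd⟩
    have := hdom.le
    dsimp only at this ⊢
    linarith

theorem IInvariant.of_reachable (hI : ∀ k, ∀ p ∈ I.locs k, w.OnAisle p)
    (harr : ∀ k, 0 ≤ I.arr k) {s : IState n}
    (hs : Relation.ReflTransGen (IStep w sys c I) ⟨0, w.depot, ∅, [], [], ∅⟩ s) :
    IInvariant w sys c I s := by
  induction hs with
  | refl => exact IInvariant.initial harr
  | tail _ hstep ih => exact ih.step hI hstep

theorem ciopt_le_of_isIReopt (hI : ∀ k, ∀ p ∈ I.locs k, w.OnAisle p) (harr : ∀ k, 0 ≤ I.arr k)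
    {T : ℝ} (hT : IsIReopt w sys c I T) : CIOPT w sys c I ≤ T := by
  obtain ⟨s, hs, ⟨hcur, hfut, -, hpos⟩, hk, rfl⟩ := hT
  obtain ⟨done, picked, -, hdom, hd⟩ := (IInvariant.of_reachable hI harr hs).exists_done
  rw [hcur, hfut, List.append_nil, hk] at hd
  refine (ciopt_le w sys I hI hd).trans ?_
  rw [completion, List.foldl_append]
  have := (hdom.batchEnd (sys := sys)).time_le
  simpa [serveBatch, ← hpos] using this

theorem IInvariant.exists_reopt (hc : 1 ≤ c) {s : IState n} (h : IInvariant w sys c I s)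
    (hnew : ∃ k, k ∉ s.known ∧ I.arr k ≤ s.time) :
    ∃ cur fut, IStep w sys c I s ⟨s.time, s.pos, s.cart, cur, fut, I.arrived s.time⟩ := by
  obtain ⟨cur, fut, hP⟩ := exists_isOptimalReplan w sys hc s.pos h.card_cart_le
    ((finite_itemsOf I Finset.univ).subset (h.todo_subset (I.arrived s.time \ s.known)))
  exact ⟨cur, fut, IStep.reopt s cur fut hnew hP⟩

theorem IInvariant.walkable_dest (hI : ∀ k, ∀ p ∈ I.locs k, w.OnAisle p) {s : IState n}
    (h : IInvariant w sys c I s) : w.Walkable (s.dest w sys) := by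
  cases hcur : s.cur with
  | nil => simpa [IState.dest, hcur] using walkable_batchEnd h.walkable_pos
  | cons x B =>
    simp only [IState.dest, hcur]
    exact Or.inl (hI _ _ (h.plan_subset (x := x) (by simp [hcur])).2)

open Classical in
variable (w sys) in
/-- The number of picks and batch ends that are still planned. -/
noncomputable def IState.remaining (s : IState n) : ℕ :=
  (s.cur ++ s.fut.flatten).length + s.fut.length + if s.Idle w sys then 0 else 1

theorem IState.remaining_le (s : IState n) :
    s.remaining w sys ≤ (s.cur ++ s.fut.flatten).length + s.fut.length + 1 := by
  unfold IState.remaining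
  split_ifs <;> omega

theorem IState.remaining_of_not_idle {s : IState n} (hni : ¬ s.Idle w sys) :
    s.remaining w sys = (s.cur ++ s.fut.flatten).length + s.fut.length + 1 := by
  rw [IState.remaining, if_neg hni]

/-- As long as no order arrives, the policy proceeds with its plan. -/
theorem IState.exists_step (c : ℕ) {s : IState n} (hni : ¬ s.Idle w sys)
    (ht : ∀ k, k ∉ s.known → s.time + w.d s.pos (s.dest w sys) ≤ I.arr k) :
    ∃ s', IStep w sys c I s s' ∧ s'.known = s.known ∧ s'.remaining w sys < s.remaining w sys := by
  cases hcur : s.cur with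
  | cons x B =>
    refine ⟨_, IStep.pick s x B hcur (by simpa [IState.dest, hcur] using ht), rfl, ?_⟩
    rw [IState.remaining_of_not_idle hni, hcur]
    refine (IState.remaining_le _).trans_lt ?_
    simp
  | nil =>
    refine ⟨_, IStep.close s hcur hni (by simpa [IState.dest, hcur] using ht), rfl, ?_⟩
    -- If no batch is left, closing leads to an idle state and saves the final 1 of `remaining`;
    -- otherwise the list of later batches gets shorter.
    cases hfut : s.fut with
    | nil =>
      simp only [IState.remaining, if_neg hni, hcur, hfut]
      rw [if_pos ⟨rfl, rfl, rfl, (batchEnd_batchEnd _).symm⟩]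
      simp
    | cons B P =>
      rw [IState.remaining_of_not_idle hni, hcur, hfut]
      refine (IState.remaining_le _).trans_lt ?_
      simp

/-- Induction on the number of unknown orders, then on `remaining`. Idle and walk steps are followed
at once by a replanning; the interruption point of a walk exists because the metric is geodesic
(`Warehouse.exists_between`). -/
theorem IInvariant.exists_completion (hI : ∀ k, ∀ p ∈ I.locs k, w.OnAisle p) (hc : 1 ≤ c)
    {s : IState n} (h : IInvariant w sys c I s) :
    ∃ s', Relation.ReflTransGen (IStep w sys c I) s s' ∧ s'.Idle w sys ∧
      s'.known = Finset.univ := by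
  obtain ⟨m, hm⟩ : ∃ m, s.knownᶜ.card = m := ⟨_, rfl⟩
  induction m using Nat.strong_induction_on generalizing s with
  | _ m ih =>
  have reopt : ∀ s : IState n, IInvariant w sys c I s → s.knownᶜ.card = m →
      (∃ k, k ∉ s.known ∧ I.arr k ≤ s.time) →
      ∃ s', Relation.ReflTransGen (IStep w sys c I) s s' ∧ s'.Idle w sys ∧
        s'.known = Finset.univ := by
    intro s h hm hnew
    obtain ⟨cur, fut, hP⟩ := h.exists_reopt hc hnew
    obtain ⟨s', hs', h'⟩ :=
      ih _ (hm ▸ card_compl_arrived_lt h.known_arrived hnew) (h.step hI hP) rfl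
    exact ⟨s', .head hP hs', h'⟩
  obtain ⟨l, hl⟩ : ∃ l, s.remaining w sys = l := ⟨_, rfl⟩
  induction l using Nat.strong_induction_on generalizing s with
  | _ l ihl =>
  by_cases hnew : ∃ k, k ∉ s.known ∧ I.arr k ≤ s.time
  · exact reopt s h hm hnew
  push Not at hnew
  by_cases hidle : s.Idle w sys
  · by_cases hu : s.known = Finset.univ
    · exact ⟨s, .refl, hidle, hu⟩
    · obtain ⟨k, hk⟩ := I.exists_isNext hu
      have hstep := IStep.idle (c := c) s k hidle hk (hnew k hk.1)
      obtain ⟨s', hs', h'⟩ := reopt _ (h.step hI hstep) hm ⟨k, hk.1, le_rfl⟩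
      exact ⟨s', .head hstep hs', h'⟩
  · by_cases ht : ∀ k, k ∉ s.known → s.time + w.d s.pos (s.dest w sys) ≤ I.arr k
    · obtain ⟨s', hstep, hknown, hlt⟩ := s.exists_step c hidle ht
      obtain ⟨s'', hs', h'⟩ := ihl _ (hl ▸ hlt) (h.step hI hstep) (hknown ▸ hm) rfl
      exact ⟨s'', .head hstep hs', h'⟩
    · push Not at ht
      obtain ⟨k₀, hk₀, hlt₀⟩ := ht
      obtain ⟨k, hk⟩ := I.exists_isNext fun hu : s.known = Finset.univ =>
        hk₀ (hu ▸ Finset.mem_univ k₀)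
      have hlt := (hk.2 k₀ hk₀).trans_lt hlt₀
      have hgt := hnew k hk.1
      obtain ⟨p, hp, hp₁, hp₂⟩ := w.exists_between h.walkable_pos (h.walkable_dest hI)
        (t := I.arr k - s.time) (by linarith) (by linarith)
      have hstep := IStep.walk (c := c) s k p hk hgt hlt.le hp hp₁ hp₂
      obtain ⟨s', hs', h'⟩ := reopt _ (h.step hI hstep) hm ⟨k, hk.1, le_rfl⟩
      exact ⟨s', .head hstep hs', h'⟩

theorem exists_isIReopt (hI : ∀ k, ∀ p ∈ I.locs k, w.OnAisle p) (harr : ∀ k, 0 ≤ I.arr k)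
    (hc : 1 ≤ c) : ∃ T, IsIReopt w sys c I T := by
  obtain ⟨s, hs, hidle, hk⟩ :=
    (IInvariant.initial (w := w) (sys := sys) (c := c) harr).exists_completion hI hc
  exact ⟨s.time, s, hs, hidle, hk, rfl⟩

/-- An optimal replanning exceeds the complete-information optimum by a bounded amount. -/
theorem IsOptimalReplan.completion_le (hI : ∀ k, ∀ p ∈ I.locs k, w.OnAisle p) (hc : 1 ≤ c)
    (harr : ∀ k, 0 ≤ I.arr k) {C : ℝ} (hC0 : 0 ≤ C)
    (hC : ∀ B : Tour n, (∀ x ∈ B, w.OnAisle x.2) →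
      ∃ B', B'.Perm B ∧ ∀ p, w.Walkable p → (serve w (fun _ => 0) B' (p, 0)).2 ≤ C)
    {p : Pt} (hp : w.Walkable p) {cart : Finset (Fin n)} (hcart : cart.card ≤ c)
    {Q : Set (Item n)} (hQ : Q ⊆ I.itemsOf Finset.univ) {cur : Tour n} {fut : List (Tour n)}
    (h : IsOptimalReplan w sys c p cart Q cur fut) :
    completion w sys (fun _ => 0) (p, 0) (cur :: fut) ≤
      CIOPT w sys c I + (C + 4 * (w.len + w.wid)) := by
  classical
  have hL := w.len_nonneg
  have hW := w.wid_nonneg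
  rw [← sub_le_iff_le_add]
  refine le_ciopt w _ hc I fun P hP => ?_
  rw [sub_le_iff_le_add]
  have hQfin : Q.Finite := (finite_itemsOf I Finset.univ).subset hQ
  obtain ⟨B, hperm, hB⟩ := hC (hQfin.toFinset.filter fun x => x.1 ∈ cart).toList fun x hx => by
    simp only [Finset.mem_toList, Finset.mem_filter, Set.Finite.mem_toFinset] at hx
    exact hI _ _ (hQ hx.1).2
  have hmem : ∀ x, x ∈ B ↔ x ∈ Q ∧ x.1 ∈ cart := fun x => by rw [hperm.mem_iff]; simp
  have hBw : ∀ x ∈ B, w.Walkable x.2 := fun x hx => Or.inl (hI _ _ (hQ ((hmem x).1 hx).1).2)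
  have hew := walkable_serve (arr := fun _ => 0) hBw (s := (p, 0)) hp
  have hbw := walkable_batchEnd (sys := sys) hew
  -- The competitor sweeps the open orders of the cart within `C`, ends the batch within one
  -- diameter, and is then at most one diameter from the depot, where the complete-information plan
  -- starts.
  have hdom : Dominates w (C + 4 * (w.len + w.wid)) (serveBatch w sys (fun _ => 0) (p, 0) B)
      (w.depot, 0) := by
    refine ⟨hbw, w.walkable_depot, ?_⟩
    have h1 := hB p hp
    have h2 := w.d_le_diam hew hbw
    have h3 := w.d_le_diam hbw w.walkable_depot
    simp only [serveBatch]
    linarith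
  obtain ⟨P', hP', hle⟩ := exists_isPlan_completion_le (sys := sys) (c := c) hI
    (Q := {x | x ∈ Q ∧ x.1 ∉ cart}) (fun x hx => hQ hx.1) hP
    (fun k => by have := harr k; positivity) hdom
  exact (h.2 B P' (isReplan_of_isPlan hcart (hperm.nodup_iff.2 (Finset.nodup_toList _)) hmem
    hP')).trans hle

/-- By `not_passed`, every replanning takes place no later than the arrival of a new order, hence by
`R`. After the last one, picking and closing leave the predicted completion unchanged. -/
theorem isIReopt_le (hI : ∀ k, ∀ p ∈ I.locs k, w.OnAisle p) (hc : 1 ≤ c)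
    (harr : ∀ k, 0 ≤ I.arr k) {R C T : ℝ} (hR0 : 0 ≤ R) (hR : ∀ k, I.arr k ≤ R) (hC0 : 0 ≤ C)
    (hC : ∀ B : Tour n, (∀ x ∈ B, w.OnAisle x.2) →
      ∃ B', B'.Perm B ∧ ∀ p, w.Walkable p → (serve w (fun _ => 0) B' (p, 0)).2 ≤ C)
    (hT : IsIReopt w sys c I T) :
    T ≤ CIOPT w sys c I + R + (C + 4 * (w.len + w.wid)) := by
  have hS0 : 0 ≤ CIOPT w sys c I := le_ciopt w _ hc I fun P _ => completion_nonneg P _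
  have hL := w.len_nonneg
  have hW := w.wid_nonneg
  have key : ∀ s, Relation.ReflTransGen (IStep w sys c I) ⟨0, w.depot, ∅, [], [], ∅⟩ s →
      s.known = Finset.univ → completion w sys (fun _ => 0) (s.pos, s.time) (s.cur :: s.fut) ≤
        CIOPT w sys c I + R + (C + 4 * (w.len + w.wid)) := by
    intro s hs
    induction hs with
    | refl =>
      intro _
      have : completion w sys (fun _ : Fin n => 0) (w.depot, 0) [[]] = 0 := by
        cases sys <;> simp [completion, serveBatch, serve, batchEnd]
      rw [this]
      positivity
    | @tail s s' hs hstep ih =>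
      have hinv := IInvariant.of_reachable hI harr hs
      have ht0 := hinv.time_nonneg
      intro hu
      cases hstep with
      | reopt cur fut hnew hP =>
        obtain ⟨k, hk, hkt⟩ := hnew
        have h1 := hP.completion_le hI hc harr hC0 hC hinv.walkable_pos hinv.card_cart_le
          (hinv.todo_subset _)
        have h2 := hinv.not_passed k hk
        have h3 := hR k
        rw [completion_zero_eq_add _ _ ht0]
        linarith
      | walk k p hk => exact absurd (hu ▸ Finset.mem_univ k) hk.1
      | pick x B hcur ht =>
        refine le_trans (le_of_eq ?_) (ih hu)
        have h1 := w.d_nonneg s.pos x.2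
        rw [hcur]
        simp only [completion, List.foldl_cons, serveBatch, serve]
        rw [max_eq_left (by positivity)]
      | close hcur hni ht =>
        refine le_trans (le_of_eq ?_) (ih hu)
        rw [hcur]
        cases hfut : s.fut with
        | nil => simp [completion, serveBatch, serve, batchEnd_batchEnd]
        | cons B P => simp [completion, serveBatch, serve]
      | idle k hidle hk => exact absurd (hu ▸ Finset.mem_univ k) hk.1
  obtain ⟨s, hs, -, hk, rfl⟩ := hT
  exact (le_foldl_serveBatch (s.cur :: s.fut) (s.pos, s.time)).trans (key s hs hk)

theorem isIReopt_le_of_depot (hI : ∀ k, ∀ p ∈ I.locs k, p = w.depot)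
    (hIa : ∀ k, ∀ p ∈ I.locs k, w.OnAisle p) (harr : ∀ k, 0 ≤ I.arr k) {R T : ℝ} (hR0 : 0 ≤ R)
    (hR : ∀ k, I.arr k ≤ R) (hT : IsIReopt w sys c I T) : T ≤ R := by
  have hend : batchEnd w sys w.depot = w.depot := by cases sys <;> rfl
  have key : ∀ s, Relation.ReflTransGen (IStep w sys c I) ⟨0, w.depot, ∅, [], [], ∅⟩ s →
      s.time ≤ R ∧ s.pos = w.depot := by
    intro s hs
    induction hs with
    | refl => exact ⟨hR0, rfl⟩
    | @tail s s' hs hstep ih =>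
      have hinv := IInvariant.of_reachable hIa harr hs
      obtain ⟨hle, hpos⟩ := ih
      have hitem : ∀ x B, s.cur = x :: B → x.2 = w.depot := fun x B hcur =>
        hI _ _ (hinv.plan_subset (x := x) (by simp [hcur])).2
      cases hstep with
      | reopt cur fut hnew hP => exact ⟨hle, hpos⟩
      | walk k p hk ht hd =>
        -- A walk step needs positive time before a destination at distance 0.
        exfalso
        have hdest : s.dest w sys = w.depot := by
          cases hcur : s.cur with
          | nil => simp [IState.dest, hcur, hpos, hend]
          | cons x B => simp [IState.dest, hcur, hitem x B hcur]
        rw [hdest, hpos, Warehouse.d_self] at hd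
        linarith
      | pick x B hcur ht =>
        have hx := hitem x B hcur
        exact ⟨by simpa [hpos, hx] using hle, hx⟩
      | close hcur hni ht =>
        exact ⟨by simpa [hpos, hend] using hle, by simp [hpos, hend]⟩
      | idle k hidle hk ht => exact ⟨hR k, hpos⟩
  obtain ⟨s, hs, -, -, rfl⟩ := hT
  exact (key s hs).1

end Policies

section Growth

variable {w : Warehouse} {sys : PickingSystem} {n c : ℕ} {I : Instance n} {arr : Fin n → ℝ}

theorem add_dist_le_serve {B : Tour n} (hB : ∀ x ∈ B, w.Walkable x.2) {s : Pt × ℝ}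
    (hs : w.Walkable s.1) {x : Item n} (hx : x ∈ B) :
    s.2 + dist s.1 x.2 ≤ (serve w arr B s).2 := by
  induction B generalizing s with
  | nil => simp at hx
  | cons y B ih =>
    have hy := hB y (by simp)
    have h1 := w.dist_le_d hs hy
    have h2 := le_max_left (s.2 + w.d s.1 y.2) (arr y.1)
    rcases List.mem_cons.1 hx with rfl | hx
    · have h3 := le_serve (w := w) (arr := arr) B (x.2, max (s.2 + w.d s.1 x.2) (arr x.1))
      simp only [serve]
      dsimp only at h3
      linarith
    · have h3 := ih (fun z hz => hB z (by simp [hz]))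
        (s := (y.2, max (s.2 + w.d s.1 y.2) (arr y.1))) hy hx
      have h4 := dist_triangle s.1 y.2 x.2
      simp only [serve]
      dsimp only at h3
      linarith

/-- A robot may start a batch at one of its locations, so the starting point gives no lower bound;
two visited places do. -/
theorem add_dist_le_serve_of_mem {B : Tour n} (hB : ∀ x ∈ B, w.Walkable x.2) {s : Pt × ℝ}
    {x y : Item n} (hx : x ∈ B) (hy : y ∈ B) :
    s.2 + dist x.2 y.2 ≤ (serve w arr B s).2 := by
  induction B generalizing s with
  | nil => simp at hx
  | cons z B ih =>
    have hz := hB z (by simp)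
    have hB' : ∀ x ∈ B, w.Walkable x.2 := fun v hv => hB v (by simp [hv])
    have h1 := w.d_nonneg s.1 z.2
    have h2 := le_max_left (s.2 + w.d s.1 z.2) (arr z.1)
    simp only [serve]
    have hfar : ∀ v ∈ z :: B, s.2 + dist z.2 v.2 ≤
        (serve w arr B (z.2, max (s.2 + w.d s.1 z.2) (arr z.1))).2 := fun v hv => by
      rcases List.mem_cons.1 hv with rfl | hv
      · have h3 := le_serve (w := w) (arr := arr) B (v.2, max (s.2 + w.d s.1 v.2) (arr v.1))
        rw [dist_self]
        dsimp only at h3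
        linarith
      · have h3 := add_dist_le_serve (arr := arr) hB'
          (s := (z.2, max (s.2 + w.d s.1 z.2) (arr z.1))) hz hv
        dsimp only at h3
        linarith
    rcases List.mem_cons.1 hx with rfl | hx
    · exact hfar y hy
    · rcases List.mem_cons.1 hy with rfl | hy
      · rw [dist_comm]
        exact hfar x (by simp [hx])
      · refine le_trans ?_ (ih hB' hx hy)
        dsimp only
        linarith

variable (w sys) in
/-- A batch that contains the order with the given locations takes at least the time `δ`, since the
picker has to leave the depot or, with a robot, has to visit two different places. -/
def NeedsTime (δ : ℝ) (L : Finset Pt) : Prop :=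
  match sys with
  | .robot => ∃ p ∈ L, ∃ q ∈ L, δ ≤ dist p q
  | _ => ∃ p ∈ L, δ ≤ dist w.depot p

/-- The condition `hs` puts a pushcart at the depot and is void for a robot. -/
theorem NeedsTime.le_serveBatch {δ : ℝ} {L : Finset Pt} (h : NeedsTime w sys δ L) {B : Tour n}
    (hB : ∀ x ∈ B, w.Walkable x.2) {k : Fin n} (hk : ∀ p ∈ L, (k, p) ∈ B) {s : Pt × ℝ}
    (hs : batchEnd w sys s.1 = s.1) (hsw : w.Walkable s.1) :
    δ + s.2 ≤ (serveBatch w sys arr s B).2 := by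
  refine le_trans ?_ (le_add_of_nonneg_right (w.d_nonneg _ _))
  have hdepot : ∀ p ∈ L, s.1 = w.depot → δ ≤ dist w.depot p → δ + s.2 ≤ (serve w arr B s).2 := by
    intro p hp hsd hδ
    have := add_dist_le_serve (arr := arr) hB hsw (hk p hp)
    rw [hsd] at this
    dsimp only at this
    linarith
  cases sys with
  | pcartN => obtain ⟨p, hp, hδ⟩ := h; exact hdepot p hp hs.symm hδ
  | pcart => obtain ⟨p, hp, hδ⟩ := h; exact hdepot p hp hs.symm hδ
  | robot =>
    obtain ⟨p, hp, q, hq, hδ⟩ := h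
    have := add_dist_le_serve_of_mem (arr := arr) hB (s := s) (hk p hp) (hk q hq)
    dsimp only at this
    linarith

/-- The duration of a batch bounds `g k` for each of its at most `c` orders; the durations add up to
the completion time. -/
theorem sum_le_mul_completion {g : Fin n → ℝ} {P : List (Tour n)}
    (hP : ∀ B ∈ P, ∀ x ∈ B, w.Walkable x.2) (hcap : ∀ B ∈ P, (ordersOf B).card ≤ c)
    (hg : ∀ B ∈ P, ∀ s : Pt × ℝ, batchEnd w sys s.1 = s.1 → w.Walkable s.1 →
      ∀ k ∈ ordersOf B, g k + s.2 ≤ (serveBatch w sys arr s B).2)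
    {s : Pt × ℝ} (hs : batchEnd w sys s.1 = s.1) (hsw : w.Walkable s.1) :
    (P.map fun B => ∑ k ∈ ordersOf B, g k).sum ≤ c * (completion w sys arr s P - s.2) := by
  induction P generalizing s with
  | nil => simp [completion]
  | cons B P ih =>
    have h1 := ih (fun C hC => hP C (by simp [hC])) (fun C hC => hcap C (by simp [hC]))
      (fun C hC => hg C (by simp [hC])) (s := serveBatch w sys arr s B) (batchEnd_batchEnd _)
      (walkable_serveBatch (hP B (by simp)) hsw)
    have h2 : ∑ k ∈ ordersOf B, g k ≤ c * ((serveBatch w sys arr s B).2 - s.2) := by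
      refine (Finset.sum_le_card_nsmul _ _ ((serveBatch w sys arr s B).2 - s.2)
        fun k hk => ?_).trans ?_
      · have := hg B (by simp) s hs hsw k hk
        linarith
      · rw [nsmul_eq_mul]
        have h3 := le_serveBatch (w := w) (sys := sys) (arr := arr) B s
        exact mul_le_mul_of_nonneg_right (by exact_mod_cast hcap B (by simp)) (by linarith)
    rw [List.map_cons, List.sum_cons]
    change _ ≤ c * (completion w sys arr (serveBatch w sys arr s B) P - s.2)
    linarith

theorem sum_le_sum_ordersOf {g : Fin n → ℝ} (hg : ∀ k, 0 ≤ g k) {P : List (Tour n)} :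
    ∑ k ∈ ordersOf P.flatten, g k ≤ (P.map fun B => ∑ k ∈ ordersOf B, g k).sum := by
  induction P with
  | nil => simp [ordersOf]
  | cons B P ih =>
    rw [List.flatten_cons, ordersOf_append, List.map_cons, List.sum_cons]
    have := Finset.sum_union_inter (s₁ := ordersOf B) (s₂ := ordersOf P.flatten) (f := g)
    have h0 : 0 ≤ ∑ k ∈ ordersOf B ∩ ordersOf P.flatten, g k := Finset.sum_nonneg fun k _ => hg k
    linarith

/-- As a batch contains at most `c` orders, the optimum grows with the number of orders that need
time. -/
theorem sum_le_mul_ciopt (hI : ∀ k, ∀ p ∈ I.locs k, w.OnAisle p) (hne : ∀ k, (I.locs k).Nonempty)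
    (hc : 1 ≤ c) {g : Fin n → ℝ} (hg0 : ∀ k, 0 ≤ g k)
    (hg : ∀ k, NeedsTime w sys (g k) (I.locs k)) :
    ∑ k, g k ≤ c * CIOPT w sys c I := by
  have hcpos : (0 : ℝ) < c := by exact_mod_cast hc
  rw [mul_comm, ← div_le_iff₀ hcpos]
  refine le_ciopt w sys hc I fun P hP => ?_
  rw [div_le_iff₀ hcpos, mul_comm]
  have hw : ∀ B ∈ P, ∀ x ∈ B, w.Walkable x.2 := fun B hB x hx =>
    Or.inl (hI _ _ ((hP.cover x).1 (List.mem_flatten_of_mem hB hx)).2)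
  have huniv : ordersOf P.flatten = Finset.univ := by
    refine Finset.eq_univ_of_forall fun k => ?_
    obtain ⟨p, hp⟩ := hne k
    exact mem_ordersOf.2 ⟨(k, p), (hP.cover _).2 ⟨Finset.mem_univ _, hp⟩, rfl⟩
  -- Since orders are not split, a batch with one item of an order contains all of them.
  have hall : ∀ B ∈ P, ∀ k ∈ ordersOf B, ∀ p ∈ I.locs k, (k, p) ∈ B := fun B hB k hk p hp => by
    have hmem : (k, p) ∈ P.flatten := (hP.cover _).2 ⟨Finset.mem_univ _, hp⟩
    obtain ⟨B', hB', hp'⟩ := List.mem_flatten.1 hmem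
    have hk' : k ∈ ordersOf B' := mem_ordersOf.2 ⟨_, hp', rfl⟩
    by_cases h : B = B'
    · rwa [h]
    · have : Std.Symm fun B B' : Tour n => Disjoint (ordersOf B) (ordersOf B') :=
        ⟨fun _ _ h => h.symm⟩
      exact absurd hk' (Finset.disjoint_left.1 (hP.unsplit.forall hB hB' h) hk)
  have h1 := sum_le_mul_completion (g := g) (arr := I.arr) (sys := sys) hw hP.capacity
    (fun B hB s hs hsw k hk => (hg k).le_serveBatch (hw B hB) (hall B hB k hk) hs hsw)
    (s := (w.depot, 0)) (by cases sys <;> rfl) w.walkable_depot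
  have h2 := sum_le_sum_ordersOf hg0 (P := P)
  rw [huniv] at h2
  simpa using h2.trans h1

theorem arr_le_ciopt (hc : 1 ≤ c) {k : Fin n} (hne : (I.locs k).Nonempty) :
    I.arr k ≤ CIOPT w sys c I := by
  refine le_ciopt w sys hc I fun P hP => ?_
  obtain ⟨p, hp⟩ := hne
  exact arr_le_completion (x := (k, p)) ((hP.cover _).2 ⟨Finset.mem_univ _, hp⟩) _

/-! ### The three systems -/

theorem exists_isReopt (hI : ∀ k, ∀ p ∈ I.locs k, w.OnAisle p) (harr : ∀ k, 0 ≤ I.arr k)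
    (hc : 1 ≤ c) : ∃ T, IsReopt w sys c I T := by
  cases sys
  exacts [exists_isNReopt hI hc, exists_isIReopt hI harr hc, exists_isIReopt hI harr hc]

theorem ciopt_le_of_isReopt (hI : ∀ k, ∀ p ∈ I.locs k, w.OnAisle p) (harr : ∀ k, 0 ≤ I.arr k)
    {T : ℝ} (hT : IsReopt w sys c I T) : CIOPT w sys c I ≤ T := by
  cases sys
  exacts [ciopt_le_of_isNReopt hI hT, ciopt_le_of_isIReopt hI harr hT,
    ciopt_le_of_isIReopt hI harr hT]

variable (w) in
/-- Reoptimization exceeds the optimum by at most the last arrival time plus a constant. -/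
theorem exists_isReopt_le : ∃ C : ℝ, ∀ (sys : PickingSystem) (c n : ℕ) (I : Instance n), 1 ≤ c →
    (∀ k, ∀ p ∈ I.locs k, w.OnAisle p) → (∀ k, 0 ≤ I.arr k) → ∀ R, 0 ≤ R → (∀ k, I.arr k ≤ R) →
    ∀ T, IsReopt w sys c I T → T ≤ CIOPT w sys c I + R + C := by
  obtain ⟨C, hC0, hC⟩ := exists_tour_bound w
  refine ⟨C + 4 * (w.len + w.wid), fun sys c n I hc hI harr R hR0 hR T hT => ?_⟩
  cases sys
  · have h1 := isNReopt_le hI hc harr hR0 hR (hC n) hT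
    have h2 := w.len_nonneg
    have h3 := w.wid_nonneg
    linarith
  · exact isIReopt_le hI hc harr hR0 hR hC0 (hC n) hT
  · exact isIReopt_le hI hc harr hR0 hR hC0 (hC n) hT

theorem isReopt_le_of_depot (hI : ∀ k, ∀ p ∈ I.locs k, p = w.depot)
    (hIa : ∀ k, ∀ p ∈ I.locs k, w.OnAisle p) (harr : ∀ k, 0 ≤ I.arr k) {R T : ℝ} (hR0 : 0 ≤ R)
    (hR : ∀ k, I.arr k ≤ R) (hT : IsReopt w sys c I T) : T ≤ R := by
  cases sys
  exacts [isNReopt_le_of_depot hI hIa hR0 hR hT, isIReopt_le_of_depot hI hIa harr hR0 hR hT,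
    isIReopt_le_of_depot hI hIa harr hR0 hR hT]

/-! ### Sequences of instances -/

/-- The arrival times are a rearrangement of the first `n` values, so bounds on these values carry
over. -/
theorem mkInstance_arr (o : ℕ → OrderTuple) (y : ℕ → ℝ) (k : Fin n) :
    ∃ j < n, (mkInstance n o y).arr k = y j :=
  ⟨Tuple.sort (fun i : Fin n => y i) k, Fin.is_lt _, rfl⟩

theorem exists_mkInstance_arr_eq (o : ℕ → OrderTuple) (y : ℕ → ℝ) {j : ℕ} (hj : j < n) :
    ∃ k, (mkInstance n o y).arr k = y j :=
  ⟨(Tuple.sort (fun i : Fin n => y i)).symm ⟨j, hj⟩, by simp [mkInstance, orderStat]⟩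

theorem IsOrder.onAisle {o : OrderTuple} (h : IsOrder w o) {p : Pt} (hp : p ∈ locSet o) :
    w.OnAisle p := by
  obtain ⟨i, -, rfl⟩ := Finset.mem_image.1 hp
  exact h.2 i

theorem IsOrder.locSet_nonempty {o : OrderTuple} (h : IsOrder w o) : (locSet o).Nonempty :=
  ⟨o.2 ⟨0, h.1⟩, Finset.mem_image_of_mem _ (Finset.mem_univ _)⟩

theorem tendsto_ratio_of_needsTime {o : ℕ → OrderTuple} {y : ℕ → ℝ} (ho : ∀ j, IsOrder w (o j))
    (hy : ∀ j, 0 ≤ y j) (hc : 1 ≤ c) (hlast : ∀ ε > 0, ∀ᶠ n : ℕ in atTop, ∀ j < n, y j ≤ ε * n)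
    {g : ℕ → ℝ} (hg0 : ∀ j, 0 ≤ g j) (hg : ∀ j, NeedsTime w sys (g j) (locSet (o j))) {κ : ℝ}
    (hκ : 0 < κ) (hsum : ∀ᶠ n : ℕ in atTop, κ * n ≤ ∑ j ∈ Finset.range n, g j) {T : ℕ → ℝ}
    (hT : ∀ n, IsReopt w sys c (mkInstance n o y) (T n)) :
    Tendsto (fun n => T n / CIOPT w sys c (mkInstance n o y)) atTop (𝓝 1) := by
  have hI : ∀ n, ∀ k, ∀ p ∈ (mkInstance n o y).locs k, w.OnAisle p := fun n k p hp =>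
    (ho k).onAisle hp
  have harr : ∀ n, ∀ k, 0 ≤ (mkInstance n o y).arr k := fun n k => by
    obtain ⟨j, -, h⟩ := mkInstance_arr o y k
    exact h ▸ hy j
  obtain ⟨C, hC⟩ := exists_isReopt_le w
  have hcpos : (0 : ℝ) < c := by exact_mod_cast hc
  have hgrow : ∀ᶠ n : ℕ in atTop, κ / c * n ≤ CIOPT w sys c (mkInstance n o y) := by
    filter_upwards [hsum] with n hn
    have h1 := sum_le_mul_ciopt (sys := sys) (hI n) (fun k => (ho k).locSet_nonempty) hc
      (g := fun k : Fin n => g k) (fun k => hg0 k) (fun k => hg k)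
    rw [Fin.sum_univ_eq_sum_range] at h1
    rw [div_mul_eq_mul_div, div_le_iff₀ hcpos]
    linarith
  refine Metric.tendsto_nhds.2 fun ε hε => ?_
  -- The last arrival and the constant `C` are each at most `η * n`, a quarter of `ε` times the
  -- lower bound for the optimum; together they stay below `ε` times the optimum.
  set η := κ / c * ε / 4 with hη
  have hη0 : 0 < η := by positivity
  have hC' : ∀ᶠ n : ℕ in atTop, C ≤ η * n :=
    (tendsto_natCast_atTop_atTop.const_mul_atTop hη0).eventually_ge_atTop C
  filter_upwards [hgrow, hlast η hη0, hC', eventually_gt_atTop 0] with n h1 h2 h3 h4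
  have hn : (0 : ℝ) < n := by exact_mod_cast h4
  have h5 := hC sys c n _ hc (hI n) (harr n) (η * n) (by positivity)
    (fun k => by
      obtain ⟨j, hj, h⟩ := mkInstance_arr o y k
      exact h ▸ h2 j hj) _ (hT n)
  have h6 := ciopt_le_of_isReopt (hI n) (harr n) (hT n)
  set S := CIOPT w sys c (mkInstance n o y) with hS
  have hS0 : 0 < S := lt_of_lt_of_le (by positivity) h1
  have h7 : η * n = κ / c * n * ε / 4 := by rw [hη]; ring
  have h8 : κ / c * n * ε ≤ S * ε := by gcongr
  rw [Real.dist_eq, div_sub_one hS0.ne', abs_of_nonneg (div_nonneg (by linarith) hS0.le),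
    div_lt_iff₀ hS0]
  have h9 : 0 < S * ε := by positivity
  linarith

/-- The last arrival bounds the policy from above and the optimum from below, so all three agree. A
positive arrival keeps the quotient from being 0/0. -/
theorem tendsto_ratio_of_depot {o : ℕ → OrderTuple} {y : ℕ → ℝ} (ho : ∀ j, IsOrder w (o j))
    (hy : ∀ j, 0 ≤ y j) (hc : 1 ≤ c) (hdepot : ∀ j i, (o j).2 i = w.depot) (hpos : ∃ j, 0 < y j)
    {T : ℕ → ℝ} (hT : ∀ n, IsReopt w sys c (mkInstance n o y) (T n)) :
    Tendsto (fun n => T n / CIOPT w sys c (mkInstance n o y)) atTop (𝓝 1) := by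
  obtain ⟨j, hj⟩ := hpos
  refine tendsto_const_nhds.congr' ?_
  filter_upwards [eventually_gt_atTop j] with n hn
  have hI : ∀ k, ∀ p ∈ (mkInstance n o y).locs k, w.OnAisle p := fun k p hp => (ho k).onAisle hp
  have hI' : ∀ k, ∀ p ∈ (mkInstance n o y).locs k, p = w.depot := fun k p hp => by
    obtain ⟨i, -, rfl⟩ := Finset.mem_image.1 hp
    exact hdepot k i
  have harr : ∀ k, 0 ≤ (mkInstance n o y).arr k := fun k => by
    obtain ⟨j, -, h⟩ := mkInstance_arr o y k
    exact h ▸ hy j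
  have : Nonempty (Fin n) := ⟨⟨j, hn⟩⟩
  obtain ⟨k, hk⟩ := Finite.exists_max (mkInstance n o y).arr
  have h1 := isReopt_le_of_depot hI' hI harr (harr k) hk (hT n)
  have h2 := ciopt_le_of_isReopt hI harr (hT n)
  have h3 := arr_le_ciopt (w := w) (sys := sys) hc (I := mkInstance n o y) (k := k)
    (ho k).locSet_nonempty
  obtain ⟨l, hl⟩ := exists_mkInstance_arr_eq o y hn
  have h4 := hk l
  rw [hl] at h4
  have h5 : T n = CIOPT w sys c (mkInstance n o y) := le_antisymm (h1.trans h3) h2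
  rw [h5, div_self (by linarith)]

end Growth

/-! ### Random instances -/

section Random

variable {Ω : Type*} [MeasurableSpace Ω] {P : Measure Ω} {w : Warehouse}

/-- With partial sums S, `y n / (n + 1)` is S(n+1)/(n+1) minus S(n)/n times n/(n+1), which tends to
m - m. The finitely many early indices are absorbed by large `n`. -/
theorem eventually_forall_lt_le {y : ℕ → ℝ} {m : ℝ}
    (h : Tendsto (fun n : ℕ => (∑ i ∈ Finset.range n, y i) / n) atTop (𝓝 m)) {ε : ℝ} (hε : 0 < ε) :
    ∀ᶠ n : ℕ in atTop, ∀ j < n, y j ≤ ε * n := by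
  have h1 : Tendsto (fun n : ℕ => y n / ((n : ℝ) + 1)) atTop (𝓝 0) := by
    have h2 := (tendsto_add_atTop_iff_nat 1).2 h
    have h3 := h2.sub (h.mul (tendsto_natCast_div_add_atTop (1 : ℝ)))
    rw [mul_one, sub_self] at h3
    refine h3.congr' ?_
    filter_upwards [eventually_gt_atTop 0] with n hn
    have hn' : (n : ℝ) ≠ 0 := by exact_mod_cast hn.ne'
    rw [Finset.sum_range_succ]
    push_cast
    field_simp
    ring
  obtain ⟨N, hN⟩ := eventually_atTop.1 (h1.eventually (gt_mem_nhds hε))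
  have h4 : ∀ᶠ n : ℕ in atTop, ∀ j ∈ Finset.range N, y j ≤ ε * n :=
    (Finset.eventually_all _).2 fun j _ =>
      (tendsto_natCast_atTop_atTop.const_mul_atTop hε).eventually_ge_atTop (y j)
  filter_upwards [h4] with n hn j hj
  by_cases hjN : j < N
  · exact hn j (Finset.mem_range.2 hjN)
  · have h5 := hN j (not_lt.1 hjN)
    rw [div_lt_iff₀ (by positivity)] at h5
    have h6 : (j : ℝ) + 1 ≤ n := by exact_mod_cast hj
    exact h5.le.trans (by gcongr)

/-- The strong law for the indicator of `E`; half of its positive mean serves as `κ`. -/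
theorem exists_linear_growth [IsProbabilityMeasure P] {α : Type*} [MeasurableSpace α]
    {O : ℕ → Ω → α} (hindep : iIndepFun O P) (hident : ∀ j, IdentDistrib (O j) (O 0) P P)
    {E : Set α} (hE : MeasurableSet E) (hpos : ¬ ∀ᵐ ω ∂P, O 0 ω ∉ E) :
    ∃ κ > 0, ∀ᵐ ω ∂P, ∀ᶠ n : ℕ in atTop,
      κ * n ≤ ∑ j ∈ Finset.range n, E.indicator (fun _ => (1 : ℝ)) (O j ω) := by
  set f : α → ℝ := E.indicator fun _ => 1 with hf
  have hfm : Measurable f := measurable_const.indicator hE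
  have hf0 : ∀ x, 0 ≤ f x := fun x => Set.indicator_nonneg (fun _ _ => zero_le_one) x
  have hf1 : ∀ x, f x ≤ 1 := fun x => Set.indicator_le_self' (fun _ _ => zero_le_one) x
  have hint : Integrable (f ∘ O 0) P := by
    refine Integrable.of_bound
      (hfm.comp_aemeasurable (hident 0).aemeasurable_fst).aestronglyMeasurable 1
      (Eventually.of_forall fun ω => ?_)
    simpa [abs_of_nonneg (hf0 _)] using hf1 (O 0 ω)
  have hmean : 0 < ∫ ω, (f ∘ O 0) ω ∂P := by
    refine lt_of_le_of_ne (integral_nonneg fun ω => hf0 _) fun h0 => hpos ?_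
    have h1 := (integral_eq_zero_iff_of_nonneg (fun ω => hf0 (O 0 ω)) hint).1 h0.symm
    filter_upwards [h1] with ω hω hmem
    simp [hf, hmem] at hω
  refine ⟨_, half_pos hmean, ?_⟩
  have hslln := strong_law_ae_real (fun j => f ∘ O j) hint
    (fun i j hij => (hindep.indepFun hij).comp hfm hfm) fun j => (hident j).comp hfm
  filter_upwards [hslln] with ω hω
  filter_upwards [hω.eventually (lt_mem_nhds (half_lt_self hmean)), eventually_gt_atTop 0]
    with n hn hn0
  have hn' : (0 : ℝ) < n := by exact_mod_cast hn0
  exact ((lt_div_iff₀ hn').1 hn).le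

/-- In the sum σ-algebra, measurability is tested separately for each number of items. -/
theorem measurableSet_exists_loc {p : Pt → Prop} (hp : MeasurableSet {x | p x}) :
    MeasurableSet {o : OrderTuple | ∃ i, p (o.2 i)} := by
  refine MeasurableSpace.measurableSet_iInf.2 fun k => ?_
  change MeasurableSet {f : Fin k → Pt | ∃ i, p (f i)}
  rw [Set.ofPred_exists]
  exact MeasurableSet.iUnion fun i => measurable_pi_apply i hp

theorem measurableSet_exists_locs {p : Pt × Pt → Prop} (hp : MeasurableSet {x | p x}) :
    MeasurableSet {o : OrderTuple | ∃ i j, p (o.2 i, o.2 j)} := by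
  refine MeasurableSpace.measurableSet_iInf.2 fun k => ?_
  change MeasurableSet {f : Fin k → Pt | ∃ i j, p (f i, f j)}
  simp only [Set.ofPred_exists]
  exact MeasurableSet.iUnion fun i => MeasurableSet.iUnion fun j =>
    ((measurable_pi_apply i).prodMk (measurable_pi_apply j)) hp

/-- If the picker has to walk with positive probability, then there are a positive time and a
measurable set of orders of positive probability that need this time. -/
theorem exists_needsTime {O : Ω → OrderTuple} {sys : PickingSystem}
    (hcart : sys ≠ .robot → ¬ ∀ᵐ ω ∂P, ∀ i, (O ω).2 i = w.depot)
    (hrobot : sys = .robot → ¬ ∀ᵐ ω ∂P, (locSet (O ω)).card ≤ 1) :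
    ∃ δ > 0, ∃ E, MeasurableSet E ∧ (∀ o ∈ E, NeedsTime w sys δ (locSet o)) ∧
      ¬ ∀ᵐ ω ∂P, O ω ∉ E := by
  have hsmall : ∀ x : ℝ, (∀ N : ℕ, x ≤ 1 / ((N : ℝ) + 1)) → x ≤ 0 := fun x hx =>
    ge_of_tendsto' tendsto_one_div_add_atTop_nhds_zero_nat hx
  have hmem : ∀ (o : OrderTuple) i, o.2 i ∈ locSet o := fun o i =>
    Finset.mem_image_of_mem _ (Finset.mem_univ i)
  -- Otherwise, for each `δ = 1 / (N + 1)`, almost surely no distance exceeds `δ`. Intersecting over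
  -- `N`, all of them vanish almost surely, which is excluded.
  by_contra! hcon
  by_cases hs : sys = .robot
  · refine hrobot hs ?_
    have h1 : ∀ N : ℕ, ∀ᵐ ω ∂P, O ω ∉ {o | ∃ i j, 1 / ((N : ℝ) + 1) < dist (o.2 i) (o.2 j)} :=
      fun N => hcon (1 / ((N : ℝ) + 1)) Nat.one_div_pos_of_nat _
        (measurableSet_exists_locs (p := fun x => 1 / ((N : ℝ) + 1) < dist x.1 x.2)
          (measurableSet_lt measurable_const (by fun_prop))) <| by
        rintro o ⟨i, j, hij⟩
        subst hs
        exact ⟨_, hmem o i, _, hmem o j, hij.le⟩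
    filter_upwards [ae_all_iff.2 h1] with ω hω
    refine Finset.card_le_one.2 fun p hp q hq => ?_
    obtain ⟨i, -, rfl⟩ := Finset.mem_image.1 hp
    obtain ⟨j, -, rfl⟩ := Finset.mem_image.1 hq
    refine dist_le_zero.1 (hsmall _ fun N => le_of_not_gt fun h => hω N ⟨i, j, h⟩)
  · refine hcart hs ?_
    have h1 : ∀ N : ℕ, ∀ᵐ ω ∂P, O ω ∉ {o | ∃ i, 1 / ((N : ℝ) + 1) < dist w.depot (o.2 i)} :=
      fun N => hcon (1 / ((N : ℝ) + 1)) Nat.one_div_pos_of_nat _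
        (measurableSet_exists_loc (p := fun x => 1 / ((N : ℝ) + 1) < dist w.depot x)
          (measurableSet_lt measurable_const (by fun_prop))) <| by
        rintro o ⟨i, hi⟩
        cases sys
        exacts [⟨_, hmem o i, hi.le⟩, ⟨_, hmem o i, hi.le⟩, absurd rfl hs]
    filter_upwards [ae_all_iff.2 h1] with ω hω
    intro i
    exact (dist_le_zero.1 (hsmall _ fun N => le_of_not_gt fun h => hω N ⟨i, h⟩)).symm

theorem NeedsTime.zero {L : Finset Pt} (hL : L.Nonempty) {sys : PickingSystem} :
    NeedsTime w sys 0 L := by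
  obtain ⟨p, hp⟩ := hL
  cases sys
  exacts [⟨p, hp, dist_nonneg⟩, ⟨p, hp, dist_nonneg⟩, ⟨p, hp, p, hp, dist_nonneg⟩]

theorem not_ae_card_le_one [IsProbabilityMeasure P] {O : Ω → OrderTuple}
    (h : 1 < ∫⁻ ω, ((locSet (O ω)).card : ℝ≥0∞) ∂P) :
    ¬ ∀ᵐ ω ∂P, (locSet (O ω)).card ≤ 1 := fun hle => by
  refine h.not_ge ((lintegral_mono_ae (g := fun _ => 1) ?_).trans (by simp))
  filter_upwards [hle] with ω hω
  exact_mod_cast hω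

end Random

end OrderPicking

theorem theorem1 {Ω : Type*} [MeasurableSpace Ω] (P : Measure Ω) [IsProbabilityMeasure P]
    (w : OrderPicking.Warehouse) (sys : OrderPicking.PickingSystem) (c : ℕ) (hc : 1 ≤ c)
    (O : ℕ → Ω → OrderPicking.OrderTuple) (Y : ℕ → Ω → ℝ)
    (hO_order : ∀ j, ∀ᵐ ω ∂P, OrderPicking.IsOrder w (O j ω))
    (hO_indep : iIndepFun O P) (hO_ident : ∀ j, IdentDistrib (O j) (O 0) P P)
    (hY_nonneg : ∀ j, ∀ᵐ ω ∂P, 0 ≤ Y j ω)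
    (hY_indep : iIndepFun Y P) (hY_ident : ∀ j, IdentDistrib (Y j) (Y 0) P P)
    (hY_mean : Integrable (Y 0) P)
    (hOY : IndepFun (fun ω j => O j ω) (fun ω j => Y j ω) P)
    (hK : sys = OrderPicking.PickingSystem.robot →
      1 < ∫⁻ ω, ((OrderPicking.locSet (O 0 ω)).card : ℝ≥0∞) ∂P)
    (hnontriv : ¬ ∀ᵐ ω ∂P, Y 0 ω = 0 ∧ ∀ i, (O 0 ω).2 i = w.depot) :
    ∀ᵐ ω ∂P,
      (∀ n, ∃ T, OrderPicking.IsReopt w sys c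
        (OrderPicking.mkInstance n (fun j => O j ω) (fun j => Y j ω)) T) ∧
      ∀ T : ℕ → ℝ,
        (∀ n, OrderPicking.IsReopt w sys c
          (OrderPicking.mkInstance n (fun j => O j ω) (fun j => Y j ω)) (T n)) →
        Tendsto (fun n => T n / OrderPicking.CIOPT w sys c
          (OrderPicking.mkInstance n (fun j => O j ω) (fun j => Y j ω))) atTop (𝓝 1) := by
  have hord := ae_all_iff.2 hO_order
  have hnn := ae_all_iff.2 hY_nonneg
  have hslln := strong_law_ae_real Y hY_mean (fun i j hij => hY_indep.indepFun hij) hY_ident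
  have hex : ∀ ω, (∀ j, OrderPicking.IsOrder w (O j ω)) → (∀ j, 0 ≤ Y j ω) →
      ∀ n, ∃ T, OrderPicking.IsReopt w sys c
        (OrderPicking.mkInstance n (fun j => O j ω) (fun j => Y j ω)) T := fun ω ho hy n =>
    OrderPicking.exists_isReopt (fun k _ hp => (ho k).onAisle hp) (fun k => by
      obtain ⟨j, -, h⟩ := OrderPicking.mkInstance_arr (fun j => O j ω) (fun j => Y j ω) k
      exact h ▸ hy j) hc
  -- In the first case no walking is needed, and nontriviality forces a positive mean arrival time.
  -- In the second, walking is needed with positive probability; for a robot this comes from `hK`.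
  by_cases hdeg : sys ≠ .robot ∧ ∀ᵐ ω ∂P, ∀ i, (O 0 ω).2 i = w.depot
  · have hdepot : ∀ᵐ ω ∂P, ∀ j i, (O j ω).2 i = w.depot := by
      have hm : MeasurableSet {o : OrderPicking.OrderTuple | ∀ i, o.2 i = w.depot} := by
        have := (OrderPicking.measurableSet_exists_loc (p := fun x => x ≠ w.depot)
          (measurableSet_singleton w.depot).compl).compl
        convert this using 1
        ext o
        simp
      exact ae_all_iff.2 fun j => (hO_ident j).symm.ae_snd hm hdeg.2
    have hmean : 0 < ∫ ω, Y 0 ω ∂P := by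
      refine lt_of_le_of_ne (integral_nonneg_of_ae (hY_nonneg 0)) fun h0 => hnontriv ?_
      have h1 := (integral_eq_zero_iff_of_nonneg_ae (hY_nonneg 0) hY_mean).1 h0.symm
      filter_upwards [h1, hdeg.2] with ω hω hω'
      exact ⟨hω, hω'⟩
    filter_upwards [hord, hnn, hslln, hdepot] with ω ho hy hlim hd
    refine ⟨hex ω ho hy, fun T hT => OrderPicking.tendsto_ratio_of_depot ho hy hc hd ?_ hT⟩
    -- Without a positive arrival all averages would be nonpositive, and so would their limit, the
    -- mean.
    by_contra! hle
    refine hmean.not_ge (le_of_tendsto' hlim fun n => ?_)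
    exact div_nonpos_of_nonpos_of_nonneg (Finset.sum_nonpos fun i _ => hle i) n.cast_nonneg
  · obtain ⟨δ, hδ, E, hE, hEδ, hpos⟩ := OrderPicking.exists_needsTime (P := P) (w := w)
      (O := O 0) (sys := sys) (fun hs h => hdeg ⟨hs, h⟩)
      fun hs => OrderPicking.not_ae_card_le_one (hK hs)
    obtain ⟨κ, hκ, hgrow⟩ := OrderPicking.exists_linear_growth hO_indep hO_ident hE hpos
    filter_upwards [hord, hnn, hslln, hgrow] with ω ho hy hlim hgr
    refine ⟨hex ω ho hy, fun T hT => OrderPicking.tendsto_ratio_of_needsTime ho hy hc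
      (fun ε hε => OrderPicking.eventually_forall_lt_le hlim hε)
      (g := fun j => δ * E.indicator (fun _ => (1 : ℝ)) (O j ω))
      (fun j => mul_nonneg hδ.le (Set.indicator_nonneg (fun _ _ => zero_le_one) _)) (fun j => ?_)
      (mul_pos hδ hκ) ?_ hT⟩
    · by_cases hj : O j ω ∈ E
      · simpa [hj] using hEδ _ hj
      · simpa [hj] using OrderPicking.NeedsTime.zero (ho j).locSet_nonempty
    · filter_upwards [hgr] with n hn
      rw [← Finset.mul_sum, mul_assoc]
      exact mul_le_mul_of_nonneg_left hn hδ.le
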